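/- Let $k$ be an algebraically closed field of characteristic $p>2$ and $X=\mathbb P^1_k=k\cup\{\infty\}$ with coordinate $x$. A *deformation datum* is a finite Galois cover $Z\to X$ of smooth projective connected curves with group $H$, together with a nonzero meromorphic differential $\omega$ on $Z$ that is logarithmic ($\omega=df/f$ for some $f\in k(Z)^\times$) and satisfies $\beta^*\omega=\chi(\beta)\omega$ for all $\beta\in H$, where $\chi:H\to\mathbb F_p^\times$ is an injective character. For $y\in X$ put $\sigma_y=(\mathrm{ord}_z(\omega)+1)/|H_z|$, where $z\in Z$ lies above $y$ and $H_z$ is its stabilizer. Write congruence modulo $p$ of rational numbers for congruence in $\mathbb Z_{(p)}$. The point $y$ is *critical* if $\sigma_y\ne1$; a critical point is *supersingular* if $\sigma_y=(p+1)/(p-1)$, a *spike* if $\sigma_y\equiv1\pmod p$, and a *singularity* in all other cases. Assume that $\infty$ is a singularity, and let $x_1,\dots,x_r$ be the distinct singularities. The *strength* is $n=\sum_y n_y$ over the critical points, where $n_y=0$ if $y$ is supersingular, $n_y=(p-1)\sigma_y$ if $y$ is a singularity, and $n_y=(p-1)(\sigma_y-1)$ if $y$ is a spike. Let $d$ be the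 number of supersingular points, $u=\prod(x-\tau)$ over the supersingular points $\tau$, and $Q=\prod_{x_i\ne\infty}(x-x_i)^{1+a_i-\nu_i}$, where $\sigma_{x_i}=\frac{a_i}{p-1}+\nu_i$ with integers $0\le a_i<p-1$ and $\nu_i\geq 0$. Let $L_\omega=\partial_x^2+\frac{Q'}{Q}\partial_x+p_2$ be the operator with $L_\omega(u)=0$. **Lemma 4.3.** 1. There are finitely many critical points. There are (unique) $\alpha_1,\dots,\alpha_r\in\mathbb F_p$ such that $L_\omega$ has local exponents $\{0,\alpha_i\}$ at $x_i\neq\infty$ and $\{-d,-d+\alpha_i\}$ at $x_i=\infty$. The strength $n$ is an integer, and, with $\alpha_i$ represented by an integer in $\{0,\dots,p-1\}$ in (c), (a) $n=(r-2)(p-1)-2d$; (b) $n$ is even and $n\equiv-\sum_{i=1}^r\alpha_i\pmod p$; (c) $n\ge\sum_{\alpha_i\ne0}(p-\alpha_i)$. 2. The same holds for operators. Let $L=\partial_x^2+p_1\partial_x+p_2$ be a Fuchsian operator on $X$ with singularities in $x_1,\dots,x_r$ and with nilpotent but nonzero $p$-curvature. (That is: $L$ and $\partial_x+p_1$ have nonzero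 polynomial solutions, and any two polynomial solutions of $L$ are linearly dependent over $k[x]^p$.) Suppose that $L$ is normalized: its monic polynomial solution $v$ of minimal degree has no zero in the $x_i\ne\infty$. Let $L$ have local exponents $\{0,\alpha_i\}$ at $x_i\ne\infty$ and $\{-\deg v,-\deg v+\alpha_i\}$ at $x_i=\infty$, with $\alpha_i\in\mathbb F_p$. If $L$ corresponds to the deformation datum $(Z,\omega)$, i.e. $p_1=Q'/Q$ and $L(u)=0$, so that the strength of $L$ is by definition that of $(Z,\omega)$, then $\deg v=d$, and (a), (b), (c) hold for $n$ and these $\alpha_i$. -/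

import Mathlib

open Polynomial

open scoped OnePoint KaehlerDifferential Pointwise

noncomputable section

namespace DefData

/-! ## Rational functions and second order operators on the projective line -/

section Operators

variable {k : Type*} [Field k]

/-- The derivative `d/dx` of a rational function. -/
def ratDeriv (f : RatFunc k) : RatFunc k :=
  (algebraMap k[X] (RatFunc k) (derivative f.num) * algebraMap k[X] (RatFunc k) f.denom
      - algebraMap k[X] (RatFunc k) f.num * algebraMap k[X] (RatFunc k) (derivative f.denom))
    / algebraMap k[X] (RatFunc k) f.denom ^ 2

/-- The rational function `f` is regular at the point `y` of the projective line `k ∪ {∞}` and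
takes the value `c` there. (`f.num` and `f.denom` are coprime and `f.denom` is monic.) -/
def HasValueAt (f : RatFunc k) : OnePoint k → k → Prop
  | ∞, c => f.num.natDegree ≤ f.denom.natDegree ∧ f.num.coeff f.denom.natDegree = c
  | OnePoint.some a, c => f.denom.eval a ≠ 0 ∧ f.num.eval a = c * f.denom.eval a

/-- The operator `L = (d/dx)² + p₁ (d/dx) + p₂` with rational coefficients. -/
@[ext]
structure DiffOp (k : Type*) [Field k] where
  p₁ : RatFunc k
  p₂ : RatFunc k

namespace DiffOp

/-- `L(u) = 0` for a polynomial `u`. -/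
def IsSolution (L : DiffOp k) (u : k[X]) : Prop :=
  algebraMap k[X] (RatFunc k) (derivative (derivative u))
    + L.p₁ * algebraMap k[X] (RatFunc k) (derivative u)
    + L.p₂ * algebraMap k[X] (RatFunc k) u = 0

/-- The polynomial `w` is a solution of the Wronskian equation `w' + p₁ w = 0` of `L`. -/
def IsWronskianSolution (L : DiffOp k) (w : k[X]) : Prop :=
  algebraMap k[X] (RatFunc k) (derivative w) + L.p₁ * algebraMap k[X] (RatFunc k) w = 0

/-- `L` has a regular singularity (or is regular) at `y`, with local exponents `{e, e'}`. At a
finite point `a` these are the roots of `T (T - 1) + A T + B`, where `A`, `B` are the values at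
`a` of `(x - a) p₁` and `(x - a)² p₂`; at infinity they are the roots of `T (T + 1) - A T + B`,
where `A`, `B` are the values at `∞` of `x p₁` and `x² p₂`. -/
def HasLocalExponents (L : DiffOp k) : OnePoint k → k → k → Prop
  | ∞, e, e' =>
      HasValueAt (RatFunc.X * L.p₁) ∞ (1 + (e + e')) ∧
      HasValueAt (RatFunc.X ^ 2 * L.p₂) ∞ (e * e')
  | OnePoint.some a, e, e' =>
      HasValueAt ((RatFunc.X - RatFunc.C a) * L.p₁) a (1 - (e + e')) ∧
      HasValueAt ((RatFunc.X - RatFunc.C a) ^ 2 * L.p₂) a (e * e')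

/-- `L` is Fuchsian with singularities in the set `S`, which contains `∞`: the function `pᵢ` is
regular outside `S`, has a pole of order at most `i` at the finite points of `S`, and vanishes to
order at least `i` at infinity. -/
def IsFuchsian (L : DiffOp k) (S : Set (OnePoint k)) : Prop :=
  (∞ : OnePoint k) ∈ S ∧
  (∀ a : k, (a : OnePoint k) ∉ S → (∃ c, HasValueAt L.p₁ a c) ∧ ∃ c, HasValueAt L.p₂ a c) ∧
  (∀ a : k, (a : OnePoint k) ∈ S →
    (∃ c, HasValueAt ((RatFunc.X - RatFunc.C a) * L.p₁) a c) ∧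
    ∃ c, HasValueAt ((RatFunc.X - RatFunc.C a) ^ 2 * L.p₂) a c) ∧
  (∃ c, HasValueAt (RatFunc.X * L.p₁) ∞ c) ∧ ∃ c, HasValueAt (RatFunc.X ^ 2 * L.p₂) ∞ c

/-- Both `L` and its Wronskian equation have a nonzero polynomial solution. -/
def HasNilpotentPCurvature (L : DiffOp k) : Prop :=
  (∃ u : k[X], u ≠ 0 ∧ L.IsSolution u) ∧ ∃ w : k[X], w ≠ 0 ∧ L.IsWronskianSolution w

/-- For `L` with nilpotent `p`-curvature: the polynomial solutions form a space of dimension one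
over the ring `k[x]^p` of `p`-th powers, i.e. any two of them are linearly dependent over it. -/
def HasNonzeroPCurvature (p : ℕ) (L : DiffOp k) : Prop :=
  ∀ u v : k[X], L.IsSolution u → L.IsSolution v →
    ∃ a b : k[X], (a ≠ 0 ∨ b ≠ 0) ∧ a ^ p * u + b ^ p * v = 0

/-- `u` is a monic polynomial solution of minimal degree. -/
def IsMinimalSolution (L : DiffOp k) (u : k[X]) : Prop :=
  u.Monic ∧ L.IsSolution u ∧ ∀ v : k[X], v ≠ 0 → L.IsSolution v → u.natDegree ≤ v.natDegree

/-- The shape of the local exponents of a normalized operator: `{0, α}` at a finite point and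
`{-d, -d + α}` at infinity, with `α` in the prime field. -/
def HasNormalizedExponent {p : ℕ} (L : DiffOp k) (d : ℕ) (y : OnePoint k) (α : ZMod p) : Prop :=
  match y with
  | ∞ => L.HasLocalExponents ∞ (-(d : k)) (-(d : k) + (α.val : k))
  | OnePoint.some a => L.HasLocalExponents a 0 (α.val : k)

end DiffOp

end Operators

/-! ## Smooth projective curves through their function fields -/

section Curves

variable {k F : Type*} [Field k] [Field F] [Algebra k F]

/-- A closed point of the smooth projective curve over `k` with function field `F`: a nontrivial
valuation ring of `F` that contains the constants. -/
structure Place (k F : Type*) [Field k] [Field F] [Algebra k F] where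
  ring : ValuationSubring F
  const_mem : ∀ c : k, algebraMap k F c ∈ ring
  ne_top : ring ≠ ⊤

namespace Place

/-- `t` generates the maximal ideal of the local ring at `z`. -/
def IsUniformizer (z : Place k F) (t : F) : Prop :=
  z.ring.valuation t < 1 ∧ ∀ f : F, z.ring.valuation f < 1 → z.ring.valuation f ≤ z.ring.valuation t

/-- The meromorphic differential `ω` has order `n` at `z`: it is `h dt` with `t` a local
parameter at `z` and `h` a unit at `z` times `t ^ n`. -/
def HasOrder (z : Place k F) (ω : Ω[F⁄k]) (n : ℤ) : Prop :=
  ∃ t h : F, z.IsUniformizer t ∧ ω = h • KaehlerDifferential.D k F t ∧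
    z.ring.valuation h = z.ring.valuation t ^ n

open Classical in
/-- The order at `z` of the nonzero meromorphic differential `ω`. -/
def order (z : Place k F) (ω : Ω[F⁄k]) : ℤ :=
  if h : ∃ n : ℤ, z.HasOrder ω n then h.choose else 0

/-- The point `z` of the cover of the projective line given by `k(x) → F` lies over `y`. -/
def LiesOver [Algebra (RatFunc k) F] (z : Place k F) : OnePoint k → Prop
  | ∞ => algebraMap (RatFunc k) F RatFunc.X ∉ z.ring
  | OnePoint.some a => z.ring.valuation (algebraMap (RatFunc k) F (RatFunc.X - RatFunc.C a)) < 1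

end Place

/-- The differentials of `F` over `k`, with `F` acting through the automorphism `β`. -/
def Twisted (_β : F ≃ₐ[k] F) : Type _ := Ω[F⁄k]

instance (β : F ≃ₐ[k] F) : AddCommGroup (Twisted β) := inferInstanceAs (AddCommGroup Ω[F⁄k])

instance (β : F ≃ₐ[k] F) : Module k (Twisted β) := inferInstanceAs (Module k Ω[F⁄k])

instance (β : F ≃ₐ[k] F) : Module F (Twisted β) :=
  Module.compHom (Ω[F⁄k]) (β : F →+* F)

theorem Twisted.smul_def (β : F ≃ₐ[k] F) (f : F) (ω : Ω[F⁄k]) :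
    (f • (show Twisted β from ω) : Twisted β) = (show Twisted β from (β f • ω)) := rfl

instance (β : F ≃ₐ[k] F) : IsScalarTower k F (Twisted β) where
  smul_assoc c f ω := by
    change β (c • f) • (show Ω[F⁄k] from ω) = c • (β f • (show Ω[F⁄k] from ω))
    rw [map_smul, smul_assoc]

/-- The derivation `g ↦ d(β g)`. -/
def twistedD (β : F ≃ₐ[k] F) : Derivation k F (Twisted β) :=
  Derivation.mk'
    (show F →ₗ[k] Ω[F⁄k] from
      (KaehlerDifferential.D k F).toLinearMap.comp β.toLinearEquiv.toLinearMap)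
    (fun a b => by
      change KaehlerDifferential.D k F (β (a * b)) =
        β a • KaehlerDifferential.D k F (β b) + β b • KaehlerDifferential.D k F (β a)
      rw [map_mul, Derivation.leibniz])

/-- The pullback `β^* (Σ f dg) = Σ β(f) d(β(g))` of differentials. -/
def pullback (β : F ≃ₐ[k] F) (ω : Ω[F⁄k]) : Ω[F⁄k] :=
  (twistedD β).liftKaehlerDifferential ω

theorem pullback_smul_D (β : F ≃ₐ[k] F) (f g : F) :
    pullback β (f • KaehlerDifferential.D k F g) = β f • KaehlerDifferential.D k F (β g) := by
  have h : (twistedD β).liftKaehlerDifferential (f • KaehlerDifferential.D k F g) =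
      f • twistedD β g := by
    rw [map_smul, Derivation.liftKaehlerDifferential_comp_D]
  exact h

end Curves

/-! ## Deformation data -/

/-- A deformation datum: a finite Galois cover `Z` of the projective line over `k` (given by the
finite Galois extension `F` of `k(x)`), with group `H = Gal(F/k(x))`, an injective character
`χ : H → 𝔽_p^×`, and a nonzero meromorphic differential `ω` on `Z` with `β^* ω = χ(β) ω` for all
`β ∈ H` that is logarithmic, `ω = df / f`. -/
structure DeformationDatum (p : ℕ) (k F : Type*) [Field k] [Field F] [Algebra k F]
    [Algebra (RatFunc k) F] [IsScalarTower k (RatFunc k) F] where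
  χ : (F ≃ₐ[RatFunc k] F) →* (ZMod p)ˣ
  χ_injective : Function.Injective χ
  ω : Ω[F⁄k]
  ω_ne_zero : ω ≠ 0
  pullback_ω : ∀ β : F ≃ₐ[RatFunc k] F,
    pullback (β.restrictScalars k) ω = (((χ β : ZMod p).val : ℕ) : k) • ω
  logarithmic : ∃ f : F, f ≠ 0 ∧ ω = f⁻¹ • KaehlerDifferential.D k F f

/-- Congruence modulo `p` of rational numbers: the difference is `p` times a rational number with
denominator prime to `p`. -/
def RatModEq (p : ℕ) (a b : ℚ) : Prop := ∃ c : ℚ, ¬ p ∣ c.den ∧ a - b = p * c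

namespace DeformationDatum

variable {p : ℕ} {k F : Type*} [Field k] [Field F] [Algebra k F]
  [Algebra (RatFunc k) F] [IsScalarTower k (RatFunc k) F]

/-- `(ord_z(ω) + 1) / |H_z|`, where `H_z` is the stabilizer of the point `z` of the cover. -/
def sigmaAt (D : DeformationDatum p k F) (z : Place k F) : ℚ :=
  ((z.order D.ω : ℚ) + 1) / (Nat.card (MulAction.stabilizer (F ≃ₐ[RatFunc k] F) z.ring) : ℚ)

open Classical in
/-- The ramification invariant `σ_y`, computed at some point `z` above `y` (one exists). -/
def sigma (D : DeformationDatum p k F) (y : OnePoint k) : ℚ :=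
  if h : ∃ z : Place k F, z.LiesOver y then D.sigmaAt h.choose else 0

def IsCritical (D : DeformationDatum p k F) (y : OnePoint k) : Prop := D.sigma y ≠ 1

def IsSupersingular (D : DeformationDatum p k F) (y : OnePoint k) : Prop :=
  D.IsCritical y ∧ D.sigma y = ((p : ℚ) + 1) / ((p : ℚ) - 1)

def IsSingular (D : DeformationDatum p k F) (y : OnePoint k) : Prop :=
  D.IsCritical y ∧ ¬ D.IsSupersingular y ∧ ¬ RatModEq p (D.sigma y) 1

def IsSpike (D : DeformationDatum p k F) (y : OnePoint k) : Prop :=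
  D.IsCritical y ∧ RatModEq p (D.sigma y) 1

open Classical in
/-- The contribution `n_y` of `y` to the strength. -/
def localStrength (D : DeformationDatum p k F) (y : OnePoint k) : ℚ :=
  if D.IsSingular y then ((p : ℚ) - 1) * D.sigma y
  else if D.IsSpike y then ((p : ℚ) - 1) * (D.sigma y - 1)
  else 0

/-- The strength: the sum of the `n_y` over the (finitely many) critical points. -/
def strength (D : DeformationDatum p k F) : ℚ :=
  ∑ᶠ y ∈ {y : OnePoint k | D.IsCritical y}, D.localStrength y

/-- The number of supersingular points. -/
def numSupersingular (D : DeformationDatum p k F) : ℕ :=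
  {y : OnePoint k | D.IsSupersingular y}.ncard

/-- The integer `ν` in `σ_y = a / (p - 1) + ν` with integers `ν` and `0 ≤ a < p - 1`. -/
def nu (D : DeformationDatum p k F) (y : OnePoint k) : ℤ := ⌊D.sigma y⌋

/-- The integer `a` in `σ_y = a / (p - 1) + ν` with integers `ν` and `0 ≤ a < p - 1`. -/
def aInv (D : DeformationDatum p k F) (y : OnePoint k) : ℤ :=
  ⌊((p : ℚ) - 1) * Int.fract (D.sigma y)⌋

/-- The monic polynomial with simple zeros exactly in the (finite) supersingular points. -/
def uPoly (D : DeformationDatum p k F) : k[X] :=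
  ∏ᶠ a ∈ {a : k | D.IsSupersingular a}, (X - C a)

/-- `Q = ∏ (x - xᵢ) ^ (1 + aᵢ - νᵢ)` over the finite singularities `xᵢ`. -/
def QFun (D : DeformationDatum p k F) : RatFunc k :=
  ∏ᶠ a ∈ {a : k | D.IsSingular a},
    (RatFunc.X - RatFunc.C a) ^ (1 + D.aInv (a : OnePoint k) - D.nu (a : OnePoint k))

/-- The operator `L_ω` of a deformation datum: `L_ω = (d/dx)² + (Q'/Q) (d/dx) + p₂`, where `p₂` is
determined by `L_ω(u) = 0`, for `u` the polynomial with simple zeros in the supersingular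
points. -/
def operator (D : DeformationDatum p k F) : DiffOp k where
  p₁ := ratDeriv D.QFun / D.QFun
  p₂ := -(algebraMap k[X] (RatFunc k) (derivative (derivative D.uPoly))
      + ratDeriv D.QFun / D.QFun * algebraMap k[X] (RatFunc k) (derivative D.uPoly))
    / algebraMap k[X] (RatFunc k) D.uPoly

/-- The operator `L` (with the same singularities as `D`) is the one that belongs to the deformation
datum: `p₁ = Q'/Q`, and the polynomial with simple zeros in the supersingular points is a
solution. -/
def CorrespondsTo (D : DeformationDatum p k F) (L : DiffOp k) : Prop :=
  L.p₁ = ratDeriv D.QFun / D.QFun ∧ L.IsSolution D.uPoly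

end DeformationDatum

end DefData

end

/-!
Write `ω = h dx`. The eigenvalue condition `β^* ω = χ(β) ω` says that `h ^ (p - 1)` is invariant
under the Galois group, hence is a rational function `G` of `x` (`exists_pow_eq`): the tensor
`ω ^ (p - 1) = G (dx) ^ (p - 1)` descends to the projective line. Let `N y` be its order at `y`
(`tensorOrder`); these orders add up to `-2 (p - 1)`.

At a place `z` above `y`, the stabilizer has order the ramification index `e`, by the theory of
Galois extensions of Dedekind domains applied to the integral closure of `k[s]`, with `s` a local
parameter at `y`. As `e` divides `p - 1`, the ramification is tame, so `ds` has order `e - 1` at `z`,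
and it follows that `σ_y = 1 + N y / (p - 1)` (`sigmaAt_eq`, `sigma_eq`). Since `ω = df / f` has at
most simple poles, `N y ≥ -(p - 1)`. To compare orders of differentials with respect to different
uniformizers `t` one needs that `d` maps functions regular at `z` to regular multiples of `dt`; this
is Nakayama's lemma for the module of the differentials of the local ring at `z`
(`exists_D_eq_smul_D`).

Everything about the strength is now arithmetic of the integers `N y` (`strength_properties`): a
point is critical if `N y ≠ 0`, supersingular if `N y = 2`, a spike if `N y` is a nonzero multiple
of `p` (and then `N y > 0`), and a singularity otherwise, and `α_i = 1 - N x_i`. The exponent of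
`x - x_i` in `Q` is congruent to `N x_i` modulo `p`, so `p₁` is the sum of the `N x_i / (x - x_i)`,
and the local exponents can be read off because `u` does not vanish at the finite singularities
(`DiffOp.hasNormalizedExponent_of_eq`).

For the second part, the polynomial with simple zeros in the supersingular points is a solution of
`L`, and any other solution is a multiple of it by a quotient of `p`-th powers. A simple zero cannot
be removed by such a factor, so this solution has minimal degree
(`DiffOp.natDegree_le_of_squarefree`).
-/

/-! ### The centre of a valuation ring on an integral closure -/

namespace DefData
section LocalStructure
open IsDedekindDomain

variable {k F : Type*} [Field k] [Field F] [Algebra k F] {O : ValuationSubring F}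

theorem aeval_mem (hk : ∀ c : k, algebraMap k F c ∈ O) {s : F} (hs : s ∈ O)
    (q : k[X]) : aeval s q ∈ O := by
  induction q using Polynomial.induction_on with
  | C c => simpa using hk c
  | add p q hp hq => rw [map_add]; exact add_mem hp hq
  | monomial n c _ =>
    rw [map_mul, aeval_C, map_pow, aeval_X]
    exact mul_mem (hk c) (pow_mem hs _)

variable [Algebra k[X] F] [IsScalarTower k k[X] F]

theorem algebraMap_eq_aeval (q : k[X]) :
    algebraMap k[X] F q = aeval (algebraMap k[X] F X) q := by
  rw [aeval_algebraMap_apply, aeval_X_left_apply]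

/-- `O` contains the integral closure of `k[X]`. -/
theorem mem_of_isIntegral (hk : ∀ c : k, algebraMap k F c ∈ O)
    (hX : algebraMap k[X] F X ∈ O) {b : F} (hb : IsIntegral k[X] b) : b ∈ O := by
  obtain ⟨q, hq, h0⟩ := hb
  let φ : k[X] →+* O := (algebraMap k[X] F).codRestrict O.toSubring
    (fun q => by rw [algebraMap_eq_aeval]; exact aeval_mem hk hX q)
  have hint : IsIntegral O b := by
    refine ⟨q.map φ, hq.map φ, ?_⟩
    rw [eval₂_map]
    exact h0
  obtain ⟨y, hy⟩ := IsIntegrallyClosed.isIntegral_iff.mp hint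
  rw [← hy]
  exact y.2

/-- The centre of the valuation ring `O` on the integral closure of `k[X]`. -/
def centre (hk : ∀ c : k, algebraMap k F c ∈ O) (hX : algebraMap k[X] F X ∈ O) :
    Ideal (integralClosure k[X] F) where
  carrier := {b | O.valuation (b : F) < 1}
  add_mem' {a b} ha hb := (O.valuation.map_add _ _).trans_lt (max_lt ha hb)
  zero_mem' := by simp
  smul_mem' c x hx := by
    have hc := (O.valuation_le_one_iff _).mpr (mem_of_isIntegral hk hX c.2)
    simpa using mul_lt_one_of_nonneg_of_lt_one_right hc zero_le hx

theorem mem_centre (hk : ∀ c : k, algebraMap k F c ∈ O) (hX : algebraMap k[X] F X ∈ O)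
    (b : integralClosure k[X] F) : b ∈ centre hk hX ↔ O.valuation (b : F) < 1 := Iff.rfl

instance (hk : ∀ c : k, algebraMap k F c ∈ O) (hX : algebraMap k[X] F X ∈ O) :
    (centre hk hX).IsPrime := by
  refine ⟨?_, ?_⟩
  · rw [Ideal.ne_top_iff_one, mem_centre]
    simp
  · intro a b hab
    by_contra! h
    simp only [mem_centre, not_lt] at h hab
    refine hab.not_ge ?_
    simpa using one_le_mul h.1 h.2

theorem valuation_algebraMap_lt_one_iff (hk : ∀ c : k, algebraMap k F c ∈ O)
    (hX : O.valuation (algebraMap k[X] F X) < 1) (q : k[X]) :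
    O.valuation (algebraMap k[X] F q) < 1 ↔ X ∣ q := by
  have hX' : algebraMap k[X] F X ∈ O := (O.valuation_le_one_iff _).mp hX.le
  have key : ∀ r : k[X], O.valuation (algebraMap k[X] F (X * r)) < 1 := fun r => by
    have hr : algebraMap k[X] F r ∈ O := by
      rw [algebraMap_eq_aeval]; exact aeval_mem hk hX' r
    rw [map_mul, map_mul]
    exact mul_lt_one_of_nonneg_of_lt_one_left zero_le hX ((O.valuation_le_one_iff _).mpr hr)
  refine ⟨fun h => ?_, fun ⟨r, hr⟩ => hr ▸ key r⟩
  rw [X_dvd_iff]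
  by_contra hc
  have h1 := key q.divX
  have h2 : algebraMap k[X] F q = algebraMap k[X] F (X * q.divX) + algebraMap k F (q.coeff 0) := by
    conv_lhs => rw [← q.X_mul_divX_add, map_add]
    rw [IsScalarTower.algebraMap_apply k k[X] F]; rfl
  have h3 : O.valuation (algebraMap k F (q.coeff 0)) < 1 := by
    rw [← sub_eq_iff_eq_add'.mpr h2]
    exact (O.valuation.map_sub _ _).trans_lt (max_lt h h1)
  have h4 := (O.valuation_le_one_iff _).mpr (hk (q.coeff 0)⁻¹)
  have h5 : O.valuation (algebraMap k F (q.coeff 0) * algebraMap k F (q.coeff 0)⁻¹) < 1 := by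
    rw [map_mul]
    exact mul_lt_one_of_nonneg_of_lt_one_left zero_le h3 h4
  rw [← map_mul, mul_inv_cancel₀ hc] at h5
  simp at h5

theorem centre_liesOver (hk : ∀ c : k, algebraMap k F c ∈ O)
    (hX : O.valuation (algebraMap k[X] F X) < 1) :
    (centre hk ((O.valuation_le_one_iff _).mp hX.le)).LiesOver (Ideal.span {(X : k[X])}) := by
  constructor
  ext q
  rw [Ideal.mem_span_singleton, ← valuation_algebraMap_lt_one_iff hk hX q]
  rfl

end LocalStructure
end DefData

/-! ### Decomposition groups, uniformizers and regular differentials -/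

namespace DefData
section Ramification
open IsDedekindDomain

variable {k F : Type*} [Field k] [Field F] {O : ValuationSubring F}

/-- A valuation ring of `F` containing the Dedekind domain `B` is the one of its centre. -/
theorem mem_iff_valuation_centre_le_one {B : Type*} [CommRing B] [IsDedekindDomain B]
    [Algebra B F] [IsFractionRing B F] (w : HeightOneSpectrum B)
    (hB : ∀ b : B, algebraMap B F b ∈ O)
    (hw : ∀ b : B, b ∈ w.asIdeal ↔ O.valuation (algebraMap B F b) < 1) (f : F) :
    f ∈ O ↔ w.valuation F f ≤ 1 := by
  have hd : ∀ d : w.asIdeal.primeCompl, O.valuation (algebraMap B F d) = 1 := fun d =>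
    le_antisymm ((O.valuation_le_one_iff _).mpr (hB d)) (not_lt.mp fun h => d.2 ((hw _).mpr h))
  have key : ∀ g : F, w.valuation F g ≤ 1 → ∃ n : B, O.valuation g = O.valuation (algebraMap B F n)
      ∧ w.valuation F g = w.valuation F (algebraMap B F n) := fun g hg => by
    obtain ⟨n, d, h⟩ := w.exists_primeCompl_mul_eq_of_integer g hg
    refine ⟨n, ?_, ?_⟩
    · rw [← h, map_mul, hd, mul_one]
    · rw [← h, map_mul, (w.valuation_eq_one_iff_notMem).mpr d.2, mul_one]
  constructor
  · intro hf
    by_contra! h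
    have h0 : f ≠ 0 := by rintro rfl; simp at h
    have hi : w.valuation F f⁻¹ < 1 := by
      rw [map_inv₀]; exact inv_lt_one_of_one_lt₀ h
    obtain ⟨n, h1, h2⟩ := key _ hi.le
    rw [h2, w.valuation_lt_one_iff_mem, hw, ← h1, map_inv₀] at hi
    have := (O.valuation_le_one_iff f).mpr hf
    exact absurd ((one_le_inv₀ (by simpa [zero_lt_iff] using h0)).mpr this) hi.not_ge
  · intro hf
    obtain ⟨n, h1, -⟩ := key f hf
    rw [← O.valuation_le_one_iff, h1, O.valuation_le_one_iff]
    exact hB n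

/-- The decomposition group of a valuation ring is that of its centre. -/
theorem stabilizer_eq_stabilizer_centre {G B : Type*} [Group G] [MulSemiringAction G F]
    [CommRing B] [IsDedekindDomain B] [MulSemiringAction G B]
    [Algebra B F] [IsFractionRing B F] [SMulDistribClass G B F] (w : HeightOneSpectrum B)
    (hB : ∀ b : B, algebraMap B F b ∈ O)
    (hw : ∀ b : B, b ∈ w.asIdeal ↔ O.valuation (algebraMap B F b) < 1) :
    MulAction.stabilizer G O = MulAction.stabilizer G w.asIdeal := by
  have hsm : ∀ (g : G) (b : B), algebraMap B F (g • b) = g • algebraMap B F b := fun g b =>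
    algebraMap.coe_smul' g b F
  have hnu : ∀ f : F, O.valuation f < 1 ↔ f = 0 ∨ f⁻¹ ∉ O := fun f => by
    rw [← O.mem_nonunits_iff, O.mem_nonunits_iff_or]
  ext g
  rw [MulAction.mem_stabilizer_iff, MulAction.mem_stabilizer_iff]
  constructor
  · intro h
    ext b
    rw [Ideal.mem_pointwise_smul_iff_inv_smul_mem, hw, hw, hsm, hnu, hnu]
    conv_rhs => rw [← h]
    rw [ValuationSubring.mem_pointwise_smul_iff_inv_smul_mem]
    simp [smul_eq_zero_iff_eq]
  · intro h
    -- both `O` and `g • O` have centre `w`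
    ext f
    rw [mem_iff_valuation_centre_le_one w hB hw,
      mem_iff_valuation_centre_le_one (O := g • O) w (fun b => ?_) (fun b => ?_)]
    · rw [ValuationSubring.mem_pointwise_smul_iff_inv_smul_mem, ← hsm]
      exact hB _
    · rw [← ValuationSubring.mem_nonunits_iff, ValuationSubring.mem_nonunits_iff_or,
        ValuationSubring.mem_pointwise_smul_iff_inv_smul_mem]
      conv_lhs => rw [← h]
      rw [Ideal.mem_pointwise_smul_iff_inv_smul_mem, hw, hsm, hnu]
      simp [smul_eq_zero_iff_eq]

theorem isMaximal_span_X : (Ideal.span {(X : k[X])}).IsMaximal :=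
  ((Ideal.span_singleton_prime X_ne_zero).mpr prime_X).isMaximal (by simp)

theorem isAlgClosed_quotient_span_X [IsAlgClosed k] :
    letI := isMaximal_span_X (k := k)
    letI := Ideal.Quotient.field (Ideal.span {(X : k[X])})
    IsAlgClosed (k[X] ⧸ Ideal.span {(X : k[X])}) := by
  have := isMaximal_span_X (k := k)
  let := Ideal.Quotient.field (Ideal.span {(X : k[X])})
  refine IsAlgClosed.of_ringEquiv k _ (RingEquiv.ofBijective ((Ideal.Quotient.mk _).comp C)
    ⟨RingHom.injective _, fun y => ?_⟩)
  obtain ⟨q, rfl⟩ := Ideal.Quotient.mk_surjective y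
  refine ⟨q.coeff 0, ?_⟩
  rw [RingHom.comp_apply, Ideal.Quotient.mk_eq_mk_iff_sub_mem, Ideal.mem_span_singleton, X_dvd_iff]
  simp

/-- As `k` is algebraically closed, the residue fields above the prime `(X)` are trivial extensions. -/
theorem bijective_algebraMap_quotient [IsAlgClosed k] {B : Type*} [CommRing B]
    [Algebra k[X] B] [Module.Finite k[X] B]
    (P : Ideal B) [P.IsPrime] [P.LiesOver (Ideal.span {(X : k[X])})] :
    Function.Bijective (algebraMap (k[X] ⧸ Ideal.span {(X : k[X])}) (B ⧸ P)) := by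
  have := isMaximal_span_X (k := k)
  let := Ideal.Quotient.field (Ideal.span {(X : k[X])})
  have := isAlgClosed_quotient_span_X (k := k)
  exact IsAlgClosed.algebraMap_bijective_of_isIntegral

/-- Because the residue extension is trivial, the decomposition group is the inertia group. -/
theorem card_stabilizer_eq_ramificationIdx [IsAlgClosed k] {B : Type*} [CommRing B]
    [IsDedekindDomain B] [Algebra k[X] B] [Module.Finite k[X] B] [Module.IsTorsionFree k[X] B]
    (P : Ideal B) [P.IsPrime] [P.LiesOver (Ideal.span {(X : k[X])})]
    {G : Type*} [Group G] [Finite G] [MulSemiringAction G B]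
    [IsGaloisGroup G k[X] B] :
    Nat.card (MulAction.stabilizer G P) = (Ideal.span {(X : k[X])}).ramificationIdx' P := by
  have hbij := bijective_algebraMap_quotient (k := k) P
  set p : Ideal k[X] := Ideal.span {(X : k[X])} with hp
  have hp0 : p ≠ ⊥ := by simp [hp]
  have : p.IsMaximal := isMaximal_span_X
  let := Ideal.Quotient.field p
  have : IsAlgClosed (k[X] ⧸ p) := isAlgClosed_quotient_span_X
  have : IsAlgClosed p.ResidueField := IsAlgClosed.of_ringEquiv (k[X] ⧸ p) _
    (RingEquiv.ofBijective (algebraMap (k[X] ⧸ p) p.ResidueField)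
      p.bijective_algebraMap_quotient_residueField)
  have : P.IsMaximal :=
    Ideal.IsPrime.isMaximal inferInstance (Ideal.ne_bot_of_liesOver_of_ne_bot hp0 P)
  rw [Ideal.card_stabilizer_eq p P, Ideal.ramificationIdxIn_eq_ramificationIdx p P G,
    Ideal.inertiaDegIn_eq_inertiaDeg p P G, Ideal.inertiaDeg_eq_of_isMaximal p P,
    Ideal.ramificationIdx'_eq_ramificationIdx p P hp0,
    ← (LinearEquiv.ofBijective (Algebra.linearMap (k[X] ⧸ p) (B ⧸ P)) hbij).finrank_eq,
    Module.finrank_self, mul_one]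

variable [Algebra k[X] F]

theorem faithfulSMul_integralClosure (K : Type*) [Field K] [Algebra k[X] K]
    [IsFractionRing k[X] K] [Algebra K F] [IsScalarTower k[X] K F] :
    FaithfulSMul k[X] (integralClosure k[X] F) := by
  have : FaithfulSMul k[X] F := by
    rw [faithfulSMul_iff_algebraMap_injective, IsScalarTower.algebraMap_eq k[X] K F]
    exact (algebraMap K F).injective.comp (IsFractionRing.injective k[X] K)
  exact FaithfulSMul.tower_bot k[X] _ F

variable [Algebra k F] [IsScalarTower k k[X] F]

/-- The local structure at a place of the cover: with `s` a local parameter of the base (the image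
of `X`), the place is discrete with a uniformizer `t`, and `s` is a unit times `t ^ e`, for `e` the
order of the decomposition group. -/
theorem exists_uniformizer [IsAlgClosed k] (K : Type*) [Field K] [Algebra k[X] K]
    [IsFractionRing k[X] K] [Algebra K F] [IsScalarTower k[X] K F] [FiniteDimensional K F]
    [IsGalois K F]
    (hk : ∀ c : k, algebraMap k F c ∈ O)
    (hX : O.valuation (algebraMap k[X] F X) < 1) :
    ∃ t : F, t ≠ 0 ∧ O.valuation t < 1 ∧
      (∀ f : F, f ≠ 0 → ∃ n : ℤ, O.valuation f = O.valuation t ^ n) ∧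
      O.valuation (algebraMap k[X] F X) =
        O.valuation t ^ Nat.card (MulAction.stabilizer (F ≃ₐ[K] F) O) := by
  let B := integralClosure k[X] F
  have hX' : algebraMap k[X] F X ∈ O := (O.valuation_le_one_iff _).mp hX.le
  have : IsDedekindDomain B := integralClosure.isDedekindDomain k[X] K F
  have : IsFractionRing B F := integralClosure.isFractionRing_of_finite_extension K F
  have : Module.Finite k[X] B := IsIntegralClosure.finite k[X] K F B
  have : FaithfulSMul k[X] B := faithfulSMul_integralClosure K
  have : Module.IsTorsionFree k[X] B := inferInstance
  have : IsGaloisGroup (F ≃ₐ[K] F) k[X] B := IsGaloisGroup.of_isFractionRing _ _ _ K F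
  have : (centre hk hX').LiesOver (Ideal.span {(X : k[X])}) := centre_liesOver hk hX
  have hp0 : Ideal.span {(X : k[X])} ≠ ⊥ := by simp
  have hpp : (Ideal.span {(X : k[X])}).IsPrime := (Ideal.span_singleton_prime X_ne_zero).mpr prime_X
  let v : HeightOneSpectrum k[X] := ⟨Ideal.span {(X : k[X])}, hpp, hp0⟩
  let w : HeightOneSpectrum B :=
    ⟨centre hk hX', inferInstance, Ideal.ne_bot_of_liesOver_of_ne_bot hp0 _⟩
  have : w.asIdeal.LiesOver v.asIdeal := ‹(centre hk hX').LiesOver (Ideal.span {(X : k[X])})›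
  have hB : ∀ b : B, algebraMap B F b ∈ O := fun b => mem_of_isIntegral hk hX' b.2
  have hw : ∀ b : B, b ∈ w.asIdeal ↔ O.valuation (algebraMap B F b) < 1 := fun b => Iff.rfl
  have hO : O = (w.valuation F).valuationSubring := by
    ext f
    exact mem_iff_valuation_centre_le_one w hB hw f
  have hequiv : O.valuation.IsEquiv (w.valuation F) := by
    rw [hO]
    exact (Valuation.isEquiv_valuation_valuationSubring _).symm
  have heq : ∀ f g : F, w.valuation F f = w.valuation F g → O.valuation f = O.valuation g :=
    fun f g => hequiv.eq_iff.mpr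
  obtain ⟨t, ht⟩ := w.valuation_exists_uniformizer F
  have ht0 : t ≠ 0 := by rintro rfl; rw [map_zero] at ht; exact WithZero.exp_ne_zero ht.symm
  refine ⟨t, ht0, ?_, ?_, ?_⟩
  · rw [hequiv.lt_one_iff_lt_one, ht]; decide
  · intro f hf
    obtain ⟨n, hn⟩ : ∃ n : ℤ, w.valuation F f = WithZero.exp n :=
      ⟨_, (WithZero.exp_log ((Valuation.ne_zero_iff _).mpr hf)).symm⟩
    refine ⟨-n, ?_⟩
    rw [← map_zpow₀]
    apply heq
    rw [map_zpow₀, hn, ht, ← WithZero.exp_zsmul]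
    simp
  · have hcard := card_stabilizer_eq_ramificationIdx (k := k) (centre hk hX') (G := F ≃ₐ[K] F)
    rw [stabilizer_eq_stabilizer_centre w hB hw, show w.asIdeal = centre hk hX' from rfl, hcard,
      ← map_pow]
    apply heq
    rw [IsScalarTower.algebraMap_apply k[X] B F, w.valuation_of_algebraMap,
      ← HeightOneSpectrum.intValuation_liesOver v w, map_pow, ht]
    congr 1
    exact v.intValuation_singleton X_ne_zero rfl

/-- The ring of a place is the localization of the integral closure of `k[X]` at its centre. -/
theorem exists_fraction_eq [IsAlgClosed k] (K : Type*) [Field K] [Algebra k[X] K]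
    [IsFractionRing k[X] K] [Algebra K F] [IsScalarTower k[X] K F] [FiniteDimensional K F]
    [IsGalois K F]
    (hk : ∀ c : k, algebraMap k F c ∈ O)
    (hX : O.valuation (algebraMap k[X] F X) < 1) {f : F} (hf : f ∈ O) :
    ∃ b d : integralClosure k[X] F, O.valuation (d : F) = 1 ∧ f * d = b := by
  let B := integralClosure k[X] F
  have hX' : algebraMap k[X] F X ∈ O := (O.valuation_le_one_iff _).mp hX.le
  have : IsDedekindDomain B := integralClosure.isDedekindDomain k[X] K F
  have : IsFractionRing B F := integralClosure.isFractionRing_of_finite_extension K F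
  have : FaithfulSMul k[X] B := faithfulSMul_integralClosure K
  have : (centre hk hX').LiesOver (Ideal.span {(X : k[X])}) := centre_liesOver hk hX
  have hp0 : Ideal.span {(X : k[X])} ≠ ⊥ := by simp
  let w : HeightOneSpectrum B :=
    ⟨centre hk hX', inferInstance, Ideal.ne_bot_of_liesOver_of_ne_bot hp0 _⟩
  have hB : ∀ b : B, algebraMap B F b ∈ O := fun b => mem_of_isIntegral hk hX' b.2
  obtain ⟨n, d, h⟩ := w.exists_primeCompl_mul_eq_of_integer f
    ((mem_iff_valuation_centre_le_one w hB (fun b => Iff.rfl) f).mp hf)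
  exact ⟨n, d, le_antisymm ((O.valuation_le_one_iff _).mpr (hB d)) (not_lt.mp fun h => d.2 h), h⟩

/-- The residue field of a place is `k`. -/
theorem exists_valuation_sub_lt_one [IsAlgClosed k] (K : Type*) [Field K] [Algebra k[X] K]
    [IsFractionRing k[X] K] [Algebra K F] [IsScalarTower k[X] K F] [FiniteDimensional K F]
    [IsGalois K F]
    (hk : ∀ c : k, algebraMap k F c ∈ O)
    (hX : O.valuation (algebraMap k[X] F X) < 1) {f : F} (hf : f ∈ O) :
    ∃ c : k, O.valuation (f - algebraMap k F c) < 1 := by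
  let B := integralClosure k[X] F
  have hX' : algebraMap k[X] F X ∈ O := (O.valuation_le_one_iff _).mp hX.le
  have : IsDedekindDomain B := integralClosure.isDedekindDomain k[X] K F
  have : Module.Finite k[X] B := IsIntegralClosure.finite k[X] K F B
  have : FaithfulSMul k[X] B := faithfulSMul_integralClosure K
  have : (centre hk hX').LiesOver (Ideal.span {(X : k[X])}) := centre_liesOver hk hX
  have key : ∀ b : B, ∃ c : k, O.valuation ((b : F) - algebraMap k F c) < 1 := fun b => by
    obtain ⟨y, hy⟩ := (bijective_algebraMap_quotient (k := k) (centre hk hX')).2 (Ideal.Quotient.mk _ b)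
    obtain ⟨q, rfl⟩ := Ideal.Quotient.mk_surjective y
    rw [Ideal.Quotient.algebraMap_mk_of_liesOver, eq_comm, Ideal.Quotient.mk_eq_mk_iff_sub_mem,
      mem_centre] at hy
    have h2 : O.valuation (algebraMap k[X] F (q - C (q.coeff 0))) < 1 := by
      rw [valuation_algebraMap_lt_one_iff hk hX, X_dvd_iff]
      simp
    refine ⟨q.coeff 0, ?_⟩
    have h3 : (b : F) - algebraMap k F (q.coeff 0) =
        ((b - algebraMap k[X] B q : B) : F) + algebraMap k[X] F (q - C (q.coeff 0)) := by
      rw [IsScalarTower.algebraMap_apply k k[X] F, map_sub, IsScalarTower.algebraMap_apply k[X] B F q]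
      simp [B]
    rw [h3]
    exact (O.valuation.map_add _ _).trans_lt (max_lt hy h2)
  obtain ⟨b, d, hd, hb⟩ := exists_fraction_eq K hk hX hf
  obtain ⟨c, hc⟩ := key b
  obtain ⟨c', hc'⟩ := key d
  have h0 : c' ≠ 0 := by
    rintro rfl
    rw [map_zero, sub_zero, hd] at hc'
    exact lt_irrefl _ hc'
  refine ⟨c / c', ?_⟩
  have h0' : algebraMap k F c' ≠ 0 := by simpa using h0
  have hv : O.valuation (algebraMap k F c')⁻¹ ≤ 1 := by
    rw [← map_inv₀, O.valuation_le_one_iff]; exact hk _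
  have h1 : f - algebraMap k F (c / c') =
      (((b : F) - algebraMap k F c) - f * ((d : F) - algebraMap k F c')) * (algebraMap k F c')⁻¹ := by
    rw [map_div₀, ← hb]
    field_simp
    ring
  rw [h1, map_mul]
  refine mul_lt_one_of_nonneg_of_lt_one_left zero_le ?_ hv
  refine (O.valuation.map_sub _ _).trans_lt (max_lt hc ?_)
  rw [map_mul]
  exact mul_lt_one_of_nonneg_of_lt_one_right ((O.valuation_le_one_iff _).mpr hf) zero_le hc'

/-- The differentials of the functions regular at a place are regular multiples of `dt`. -/
theorem exists_D_eq_smul_D [IsAlgClosed k] (K : Type*) [Field K] [Algebra k[X] K]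
    [IsFractionRing k[X] K] [Algebra K F] [IsScalarTower k[X] K F] [FiniteDimensional K F]
    [IsGalois K F]
    (hk : ∀ c : k, algebraMap k F c ∈ O)
    (hX : O.valuation (algebraMap k[X] F X) < 1) {t : F} (ht : O.valuation t < 1)
    (htm : ∀ f : F, O.valuation f < 1 → O.valuation f ≤ O.valuation t) {f : F} (hf : f ∈ O) :
    ∃ g ∈ O, KaehlerDifferential.D k F f = g • KaehlerDifferential.D k F t := by
  let B := integralClosure k[X] F
  have hX' : algebraMap k[X] F X ∈ O := (O.valuation_le_one_iff _).mp hX.le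
  let := Module.compHom Ω[F⁄k] (algebraMap O F)
  have hsmul : ∀ (a : O) (m : Ω[F⁄k]), a • m = (a : F) • m := fun _ _ => rfl
  set d := KaehlerDifferential.D k F with hd
  let M : Submodule O Ω[F⁄k] := Submodule.span O (d '' O)
  have hM : ∀ f ∈ O, d f ∈ M := fun f hf => Submodule.subset_span ⟨f, hf, rfl⟩
  have hMfg : M.FG := by
    have : Module.Finite k[X] B := IsIntegralClosure.finite k[X] K F B
    obtain ⟨S, hS⟩ := this.fg_top
    let M' : Submodule O Ω[F⁄k] :=
      Submodule.span O (insert (d (algebraMap k[X] F X)) ((fun b : B => d (b : F)) '' S))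
    have hsub : ∀ (a : F) (m : Ω[F⁄k]), a ∈ O → m ∈ M' → a • m ∈ M' := fun a m ha hm =>
      M'.smul_mem ⟨a, ha⟩ hm
    have hpoly : ∀ q : k[X], d (algebraMap k[X] F q) ∈ M' := fun q => by
      rw [algebraMap_eq_aeval, Derivation.map_aeval]
      exact hsub _ _ (aeval_mem hk hX' _) (Submodule.subset_span (Set.mem_insert _ _))
    have hB : ∀ b : B, d (b : F) ∈ M' := fun b => by
      have hb : b ∈ Submodule.span k[X] (S : Set B) := hS ▸ Submodule.mem_top
      induction hb using Submodule.span_induction with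
      | mem x hx => exact Submodule.subset_span (Set.mem_insert_of_mem _ ⟨x, hx, rfl⟩)
      | zero => simp
      | add x y _ _ hx hy =>
        rw [show ((x + y : B) : F) = x + y from rfl, map_add]; exact add_mem hx hy
      | smul q x _ hx =>
        rw [show ((q • x : B) : F) = algebraMap k[X] F q * x from Algebra.smul_def q (x : F), Derivation.leibniz]
        exact add_mem (hsub _ _ (by rw [algebraMap_eq_aeval]; exact aeval_mem hk hX' _) hx)
          (hsub _ _ (mem_of_isIntegral hk hX' x.2) (hpoly q))
    have hle : M = M' := by
      refine le_antisymm (Submodule.span_le.mpr ?_) (Submodule.span_le.mpr ?_)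
      · rintro _ ⟨f, hf, rfl⟩
        obtain ⟨b, c, hc, hb⟩ := exists_fraction_eq K hk hX hf
        have hc0 : (c : F) ≠ 0 := by
          intro h; rw [h] at hc; simp at hc
        have h1 : d f = (c : F)⁻¹ • (d (b : F) - f • d (c : F)) := by
          rw [← hb, Derivation.leibniz, add_sub_cancel_left, smul_smul, inv_mul_cancel₀ hc0, one_smul]
        rw [h1]
        refine hsub _ _ ?_ (sub_mem (hB _) (hsub _ _ hf (hB _)))
        rw [← O.valuation_le_one_iff, map_inv₀, hc, inv_one]
      · rintro _ (rfl | ⟨b, -, rfl⟩)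
        · exact hM _ hX'
        · exact hM _ (mem_of_isIntegral hk hX' b.2)
    rw [hle]
    exact Submodule.fg_span ((S.finite_toSet.image _).insert _)
  have hN : M ≤ Submodule.span O {d t} := by
    refine Submodule.le_of_le_smul_of_le_jacobson_bot hMfg
      (IsLocalRing.maximalIdeal_le_jacobson (R := O) ⊥) (Submodule.span_le.mpr ?_)
    rintro _ ⟨f, hf, rfl⟩
    obtain ⟨c, hc⟩ := exists_valuation_sub_lt_one K hk hX hf
    obtain ⟨f', hf'⟩ := (O.valuation_le_iff _ _).mp (htm _ hc)
    have h1 : d f = (f' : F) • d t + t • d (f' : F) := by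
      rw [← Derivation.leibniz, hf', map_sub, Derivation.map_algebraMap, sub_zero]
    rw [h1]
    refine add_mem (Submodule.mem_sup_left (Submodule.smul_mem _ f' (Submodule.mem_span_singleton_self _)))
      (Submodule.mem_sup_right ?_)
    have htO : t ∈ O := (O.valuation_le_one_iff _).mp ht.le
    exact Submodule.smul_mem_smul (r := (⟨t, htO⟩ : O)) ((O.valuation_lt_one_iff _).mpr ht) (hM _ f'.2)
  obtain ⟨g, hg⟩ := Submodule.mem_span_singleton.mp (hN (hM f hf))
  exact ⟨g, g.2, hg.symm⟩

end Ramification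
end DefData

/-! ### Places of a cover of the projective line -/

noncomputable section
namespace DefData

section BaseField

/-- The local structure of a place of `F` above a point of the base with local parameter `s`, for
a base field `K = k(s)`. -/
theorem Place.exists_isUniformizer {k K F : Type*} [Field k] [IsAlgClosed k] [Field K] [Algebra k K]
    [Field F] [Algebra k F] [Algebra K F] [IsScalarTower k K F] [FiniteDimensional K F]
    [IsGalois K F] (z : Place k F) {s : K} (hinj : Function.Injective (aeval (R := k) s))
    (hfrac : ∀ f : K, ∃ a b : k[X], f = aeval s a / aeval s b)
    (hs : z.ring.valuation (algebraMap K F s) < 1) :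
    ∃ t : F, t ≠ 0 ∧ z.IsUniformizer t ∧
      (∀ f : F, f ≠ 0 → ∃ n : ℤ, z.ring.valuation f = z.ring.valuation t ^ n) ∧
      z.ring.valuation (algebraMap K F s) =
        z.ring.valuation t ^ Nat.card (MulAction.stabilizer (F ≃ₐ[K] F) z.ring) ∧
      ∀ f ∈ z.ring, ∃ g ∈ z.ring,
        KaehlerDifferential.D k F f = g • KaehlerDifferential.D k F t := by
  let : Algebra k[X] K := (aeval (R := k) s).toAlgebra
  let : Algebra k[X] F := ((algebraMap K F).comp (algebraMap k[X] K)).toAlgebra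
  have : IsScalarTower k[X] K F := .of_algebraMap_eq' rfl
  have : IsScalarTower k k[X] F := .of_algebraMap_eq fun c => by
    rw [IsScalarTower.algebraMap_apply k K F]
    change _ = algebraMap K F (aeval s (C c))
    rw [aeval_C]
  have : FaithfulSMul k[X] K := (faithfulSMul_iff_algebraMap_injective _ _).mpr hinj
  have : IsFractionRing k[X] K := IsFractionRing.of_field _ _ hfrac
  have hX : algebraMap k[X] F X = algebraMap K F s := congrArg (algebraMap K F) (aeval_X s)
  rw [← hX] at hs ⊢
  obtain ⟨t, ht0, ht1, ht, hts⟩ := exists_uniformizer K z.const_mem hs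
  have hmax : ∀ f : F, z.ring.valuation f < 1 → z.ring.valuation f ≤ z.ring.valuation t := by
    intro f hf
    rcases eq_or_ne f 0 with rfl | hf0
    · simp
    obtain ⟨n, hn⟩ := ht f hf0
    rw [hn] at hf ⊢
    have hv : 0 < z.ring.valuation t := by simpa [zero_lt_iff] using ht0
    rw [zpow_lt_one_iff_right_of_lt_one₀ hv ht1] at hf
    conv_rhs => rw [← zpow_one (z.ring.valuation t)]
    exact (zpow_le_zpow_iff_right_of_lt_one₀ hv ht1).mpr hf
  exact ⟨t, ht0, ⟨ht1, hmax⟩, ht, hts, fun f hf => exists_D_eq_smul_D K z.const_mem hs ht1 hmax hf⟩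

variable {k : Type*} [Field k]

/-- A local parameter of the projective line at `y`. -/
def localParam : OnePoint k → RatFunc k
  | ∞ => RatFunc.X⁻¹
  | OnePoint.some a => RatFunc.X - RatFunc.C a

/-- The order of vanishing of a nonzero rational function at `y`. -/
def ordAt : OnePoint k → RatFunc k → ℤ
  | ∞, f => f.denom.natDegree - f.num.natDegree
  | OnePoint.some a, f => f.num.rootMultiplicity a - f.denom.rootMultiplicity a

theorem aeval_ratFunc_X (q : k[X]) : aeval (RatFunc.X : RatFunc k) q = algebraMap k[X] _ q := by
  rw [← RatFunc.algebraMap_X, aeval_algebraMap_apply, aeval_X_left_apply]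

theorem aeval_localParam_some (a : k) (q : k[X]) :
    aeval (localParam (a : OnePoint k)) q = algebraMap k[X] (RatFunc k) (q.comp (X - C a)) := by
  rw [← aeval_ratFunc_X, aeval_comp]
  simp [localParam, RatFunc.algebraMap_eq_C]

theorem aeval_localParam_infty (q : k[X]) :
    algebraMap k[X] (RatFunc k) q = RatFunc.X ^ q.natDegree * aeval (localParam ∞) q.reverse := by
  have : Invertible (RatFunc.X : RatFunc k) := invertibleOfNonzero RatFunc.X_ne_zero
  have h := eval₂_reverse_mul_pow (algebraMap k (RatFunc k)) RatFunc.X q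
  rw [invOf_eq_inv] at h
  rw [← aeval_ratFunc_X, aeval_def, aeval_def, ← h, mul_comm]
  rfl

theorem aeval_localParam_injective (y : OnePoint k) :
    Function.Injective (aeval (R := k) (localParam y)) := by
  rw [injective_iff_map_eq_zero]
  intro q hq
  induction y using OnePoint.rec with
  | infty =>
    have : Invertible (RatFunc.X⁻¹ : RatFunc k) :=
      invertibleOfNonzero (inv_ne_zero RatFunc.X_ne_zero)
    have h := eval₂_reverse_mul_pow (algebraMap k (RatFunc k)) RatFunc.X⁻¹ q
    rw [invOf_eq_inv, inv_inv, ← aeval_def, ← aeval_def, aeval_ratFunc_X] at h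
    have h0 := h.trans hq
    simpa [RatFunc.X_ne_zero] using h0
  | coe a =>
    rw [aeval_localParam_some, map_eq_zero_iff _ (RatFunc.algebraMap_injective k),
      comp_eq_zero_iff] at hq
    rcases hq with h | ⟨_, h⟩
    · exact h
    · have := congrArg natDegree h
      rw [natDegree_X_sub_C, natDegree_C] at this
      exact absurd this one_ne_zero

theorem exists_aeval_localParam_div (y : OnePoint k) (f : RatFunc k) :
    ∃ a b : k[X], f = aeval (localParam y) a / aeval (localParam y) b := by
  rw [← RatFunc.num_div_denom f]
  induction y using OnePoint.rec with
  | infty =>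
    rw [aeval_localParam_infty f.num, aeval_localParam_infty f.denom]
    refine ⟨X ^ f.denom.natDegree * f.num.reverse, X ^ f.num.natDegree * f.denom.reverse, ?_⟩
    have hX : (RatFunc.X : RatFunc k) ≠ 0 := RatFunc.X_ne_zero
    simp only [map_mul, map_pow, aeval_X]
    generalize aeval (localParam (∞ : OnePoint k)) f.num.reverse = A
    generalize aeval (localParam (∞ : OnePoint k)) f.denom.reverse = B
    have h1 : ∀ n : ℕ, (RatFunc.X : RatFunc k) ^ n * localParam (∞ : OnePoint k) ^ n = 1 := fun n => by
      rw [← mul_pow, show RatFunc.X * localParam (∞ : OnePoint k) = 1 from mul_inv_cancel₀ hX, one_pow]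
    have h2 : ∀ n : ℕ, (localParam ∞ : RatFunc k) ^ n = (RatFunc.X ^ n)⁻¹ := fun n =>
      eq_inv_of_mul_eq_one_right (h1 n)
    rw [h2, h2]
    field_simp
  | coe a =>
    refine ⟨f.num.comp (X + C a), f.denom.comp (X + C a), ?_⟩
    simp only [aeval_localParam_some, comp_assoc]
    simp

end BaseField

section Valuation
variable {k F : Type*} [Field k] [Field F] [Algebra k F]

theorem Place.valuation_const {z : Place k F} {c : k} (hc : c ≠ 0) :
    z.ring.valuation (algebraMap k F c) = 1 := by
  refine le_antisymm ((z.ring.valuation_le_one_iff _).mpr (z.const_mem c)) ?_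
  have h := (z.ring.valuation_le_one_iff _).mpr (z.const_mem c⁻¹)
  rwa [map_inv₀, map_inv₀, inv_le_one₀] at h
  simpa [zero_lt_iff] using hc

/-- A polynomial in a function vanishing at `z`, with nonzero constant term, is a unit at `z`. -/
theorem Place.valuation_aeval_eq_one {z : Place k F} {s : F} (hs : z.ring.valuation s < 1)
    {q : k[X]} (hq : q.coeff 0 ≠ 0) : z.ring.valuation (aeval s q) = 1 := by
  rw [← q.X_mul_divX_add, map_add, map_mul, aeval_X, aeval_C, add_comm,
    Valuation.map_add_eq_of_lt_left, Place.valuation_const hq]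
  rw [Place.valuation_const hq, map_mul]
  exact mul_lt_one_of_nonneg_of_lt_one_left zero_le hs ((z.ring.valuation_le_one_iff _).mpr
    (aeval_mem z.const_mem ((z.ring.valuation_le_one_iff _).mp hs.le) _))

variable [Algebra (RatFunc k) F]

theorem Place.valuation_localParam_lt_one {z : Place k F} {y : OnePoint k} (hz : z.LiesOver y) :
    z.ring.valuation (algebraMap (RatFunc k) F (localParam y)) < 1 := by
  induction y using OnePoint.rec with
  | infty =>
    change z.ring.valuation (algebraMap (RatFunc k) F RatFunc.X⁻¹) < 1
    rw [map_inv₀, ← ValuationSubring.mem_nonunits_iff,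
      ValuationSubring.inv_mem_nonunits_iff]
    exact Or.inr hz
  | coe a => exact hz

variable [IsScalarTower k (RatFunc k) F]

theorem Place.valuation_polynomial {z : Place k F} {a : k} (hz : z.LiesOver (a : OnePoint k))
    {q : k[X]} (hq : q ≠ 0) :
    z.ring.valuation (algebraMap (RatFunc k) F (algebraMap k[X] (RatFunc k) q)) =
      z.ring.valuation (algebraMap (RatFunc k) F (localParam (a : OnePoint k))) ^
        q.rootMultiplicity a := by
  obtain ⟨g, hg, hd⟩ := exists_eq_pow_rootMultiplicity_mul_and_not_dvd q hq a
  have h1 : algebraMap k[X] (RatFunc k) g =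
      aeval (localParam (a : OnePoint k)) (g.comp (X + C a)) := by
    rw [aeval_localParam_some, comp_assoc]; simp
  have h2 : algebraMap k[X] (RatFunc k) (X - C a) = localParam (a : OnePoint k) := by
    simp [localParam]
  conv_lhs => rw [hg]
  rw [map_mul, map_mul, map_mul, map_pow, map_pow, map_pow, h1, ← aeval_algebraMap_apply,
    Place.valuation_aeval_eq_one (Place.valuation_localParam_lt_one hz), mul_one, h2]
  rw [coeff_zero_eq_eval_zero, eval_comp]
  simpa [dvd_iff_isRoot] using hd

theorem Place.valuation_polynomial_infty {z : Place k F} (hz : z.LiesOver ∞)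
    {q : k[X]} (hq : q ≠ 0) :
    z.ring.valuation (algebraMap (RatFunc k) F (algebraMap k[X] (RatFunc k) q)) =
      z.ring.valuation (algebraMap (RatFunc k) F (localParam ∞)) ^ (-q.natDegree : ℤ) := by
  rw [aeval_localParam_infty, map_mul, map_mul, ← aeval_algebraMap_apply,
    Place.valuation_aeval_eq_one (Place.valuation_localParam_lt_one hz) (by simpa using hq)]
  simp [localParam]

theorem Place.valuation_ratFunc {z : Place k F} {y : OnePoint k} (hz : z.LiesOver y)
    {f : RatFunc k} (hf : f ≠ 0) :
    z.ring.valuation (algebraMap (RatFunc k) F f) =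
      z.ring.valuation (algebraMap (RatFunc k) F (localParam y)) ^ ordAt y f := by
  have h0 : z.ring.valuation (algebraMap (RatFunc k) F (localParam y)) ≠ 0 := by
    have := (aeval_localParam_injective y).ne (X_ne_zero (R := k))
    simpa using this
  conv_lhs => rw [← RatFunc.num_div_denom f, map_div₀, map_div₀]
  induction y using OnePoint.rec with
  | infty =>
    rw [Place.valuation_polynomial_infty hz (RatFunc.num_ne_zero hf),
      Place.valuation_polynomial_infty hz f.denom_ne_zero, ← zpow_sub₀ h0]
    congr 1
    simp only [ordAt]; ring
  | coe a =>
    rw [Place.valuation_polynomial hz (RatFunc.num_ne_zero hf),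
      Place.valuation_polynomial hz f.denom_ne_zero, ← zpow_natCast, ← zpow_natCast,
      ← zpow_sub₀ h0]
    rfl

end Valuation
end DefData

/-! ### Orders of differentials, and existence of places -/

noncomputable section
namespace DefData

section Order

variable {k F : Type*} [Field k] [Field F] [Algebra k F] {z : Place k F}

theorem Place.IsUniformizer.ne_zero {t : F} (ht : z.IsUniformizer t) : t ≠ 0 := by
  rintro rfl
  apply z.ne_top
  rw [eq_top_iff]
  intro f _
  by_contra hf
  have h0 : f ≠ 0 := by rintro rfl; exact hf z.ring.zero_mem
  have h1 : z.ring.valuation f⁻¹ < 1 := by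
    rw [← ValuationSubring.mem_nonunits_iff, ValuationSubring.inv_mem_nonunits_iff]
    exact Or.inr hf
  have h2 := ht.2 _ h1
  simp [h0] at h2

theorem Place.IsUniformizer.valuation_pos {t : F} (ht : z.IsUniformizer t) :
    0 < z.ring.valuation t := by simpa [zero_lt_iff] using ht.ne_zero

theorem Place.IsUniformizer.mem {t : F} (ht : z.IsUniformizer t) : t ∈ z.ring :=
  (z.ring.valuation_le_one_iff _).mp ht.1.le

/-- If `s` has order `n` at `z`, then `ds = w • dt` with `w` of order at least `n - 1`, and exactly
`n - 1` when `n` is nonzero in `k`. -/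
theorem Place.IsUniformizer.exists_D_eq {t s : F} (ht : z.IsUniformizer t)
    (hD : ∀ f ∈ z.ring, ∃ g ∈ z.ring,
      KaehlerDifferential.D k F f = g • KaehlerDifferential.D k F t)
    {n : ℤ} (hs : z.ring.valuation s = z.ring.valuation t ^ n) :
    ∃ w : F, KaehlerDifferential.D k F s = w • KaehlerDifferential.D k F t ∧
      z.ring.valuation w ≤ z.ring.valuation t ^ (n - 1) ∧
      ((n : k) ≠ 0 → z.ring.valuation w = z.ring.valuation t ^ (n - 1)) := by
  have ht0 := ht.ne_zero
  have hv0 := ht.valuation_pos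
  set ε := s * t ^ (-n) with hε
  have hεv : z.ring.valuation ε = 1 := by
    rw [hε, map_mul, map_zpow₀, hs, ← zpow_add₀ hv0.ne']; simp
  have hs' : s = t ^ n * ε := by
    rw [hε, zpow_neg]; field_simp
  obtain ⟨g, hg, hDg⟩ := hD ε ((z.ring.valuation_le_one_iff _).mp hεv.le)
  have hz : KaehlerDifferential.D k F (t ^ n) =
      ((n : F) * t ^ (n - 1)) • KaehlerDifferential.D k F t := by
    rw [Derivation.leibniz_zpow, mul_smul, ← Int.cast_smul_eq_zsmul F]
  refine ⟨t ^ (n - 1) * ((n : F) * ε + t * g), ?_, ?_, fun hn => ?_⟩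
  · rw [hs', Derivation.leibniz, hz, hDg, smul_smul, smul_smul, ← add_smul]
    congr 1
    rw [zpow_sub_one₀ ht0]
    field_simp
    ring
  · rw [map_mul, map_zpow₀]
    refine mul_le_of_le_one_right zero_le ((z.ring.valuation_le_one_iff _).mpr ?_)
    have : (n : F) ∈ z.ring := intCast_mem z.ring n
    exact add_mem (mul_mem this ((z.ring.valuation_le_one_iff _).mp hεv.le)) (mul_mem ht.mem hg)
  · have hn' : z.ring.valuation (n : F) = 1 := by
      rw [← map_intCast (algebraMap k F)]
      exact Place.valuation_const hn
    have h1 : z.ring.valuation ((n : F) * ε) = 1 := by rw [map_mul, hn', hεv, one_mul]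
    rw [map_mul, map_zpow₀, Valuation.map_add_eq_of_lt_left, h1, mul_one]
    rw [h1, map_mul]
    exact mul_lt_one_of_nonneg_of_lt_one_left zero_le ht.1 ((z.ring.valuation_le_one_iff _).mpr hg)

/-- The order of a differential may be computed with any single local parameter. -/
theorem Place.order_eq {t w : F} (ht : z.IsUniformizer t)
    (hD : ∀ f ∈ z.ring, ∃ g ∈ z.ring,
      KaehlerDifferential.D k F f = g • KaehlerDifferential.D k F t)
    (hdt : KaehlerDifferential.D k F t ≠ 0) {n : ℤ}
    (hw : z.ring.valuation w = z.ring.valuation t ^ n) :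
    z.order (w • KaehlerDifferential.D k F t) = n := by
  have hex : ∃ n : ℤ, z.HasOrder (w • KaehlerDifferential.D k F t) n := ⟨n, t, w, ht, rfl, hw⟩
  rw [Place.order, dif_pos hex]
  obtain ⟨t', h, ht', heq, hh⟩ := hex.choose_spec
  set m := hex.choose
  have hvt : z.ring.valuation t' = z.ring.valuation t :=
    le_antisymm (ht.2 _ ht'.1) (ht'.2 _ ht.1)
  obtain ⟨u, hu, -, hu'⟩ := ht.exists_D_eq hD (s := t') (n := 1) (by rw [hvt, zpow_one])
  have hu1 : z.ring.valuation u = 1 := by simpa using hu'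
  rw [hu, smul_smul] at heq
  have hwu : w = h * u := by
    by_contra hne
    rw [← sub_eq_zero, ← sub_smul, smul_eq_zero] at heq
    rcases heq with h | h
    · exact hne (sub_eq_zero.mp h)
    · exact hdt h
  rw [hwu, map_mul, hu1, mul_one, hh, hvt] at hw
  exact zpow_right_injective₀ ht.valuation_pos ht.1.ne hw

end Order

section Differentials

variable {k F : Type*} [Field k] [Field F] [Algebra k F] [Algebra (RatFunc k) F]
  [IsScalarTower k (RatFunc k) F]

variable (F) in
/-- The differential `dx` on the cover. -/
def dX (k : Type*) [Field k] [Algebra k F] [Algebra (RatFunc k) F] : Ω[F⁄k] :=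
  KaehlerDifferential.D k F (algebraMap (RatFunc k) F RatFunc.X)

/-- As `F` is separable over `k(x)`, the differentials of `F` are spanned by `dx`. -/
theorem exists_eq_smul_dX [Algebra.IsSeparable (RatFunc k) F] (ω : Ω[F⁄k]) :
    ∃ h : F, ω = h • dX F k := by
  suffices h : ∀ ω : Ω[F⁄k], ω ∈ Submodule.span F {dX F k} by
    obtain ⟨h, hh⟩ := Submodule.mem_span_singleton.mp (h ω)
    exact ⟨h, hh.symm⟩
  have hpoly : ∀ q : k[X], KaehlerDifferential.D k F
      (algebraMap (RatFunc k) F (algebraMap k[X] (RatFunc k) q)) ∈ Submodule.span F {dX F k} := by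
    intro q
    rw [← aeval_ratFunc_X, ← aeval_algebraMap_apply, Derivation.map_aeval]
    exact Submodule.smul_mem _ _ (Submodule.mem_span_singleton_self _)
  have hK : ∀ f : RatFunc k, KaehlerDifferential.D k F (algebraMap (RatFunc k) F f) ∈
      Submodule.span F {dX F k} := by
    intro f
    rw [← RatFunc.num_div_denom f, map_div₀, Derivation.leibniz_div]
    exact Submodule.smul_mem _ _ (sub_mem (Submodule.smul_mem _ _ (hpoly _))
      (Submodule.smul_mem _ _ (hpoly _)))
  intro ω
  have : Algebra.FormallyUnramified (RatFunc k) F := .of_isSeparable _ _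
  have : Subsingleton Ω[F⁄RatFunc k] := Algebra.FormallyUnramified.subsingleton_kaehlerDifferential
  obtain ⟨y, rfl⟩ := (KaehlerDifferential.exact_mapBaseChange_map k (RatFunc k) F ω).mp
    (Subsingleton.elim _ _)
  induction y with
  | zero => simp
  | add x y hx hy => rw [map_add]; exact add_mem hx hy
  | tmul a η =>
    rw [KaehlerDifferential.mapBaseChange_tmul]
    refine Submodule.smul_mem _ _ ?_
    have hη : η ∈ Submodule.span (RatFunc k) (Set.range (KaehlerDifferential.D k (RatFunc k))) := by
      rw [KaehlerDifferential.span_range_derivation]; trivial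
    induction hη using Submodule.span_induction with
    | mem x hx =>
      obtain ⟨f, rfl⟩ := hx
      rw [KaehlerDifferential.map_D]
      exact hK f
    | zero => simp
    | add x y _ _ hx hy => rw [map_add]; exact add_mem hx hy
    | smul c x _ hx =>
      rw [map_smul, ← algebraMap_smul F c]
      exact Submodule.smul_mem _ _ hx

end Differentials

section Existence

variable {k F : Type*} [Field k] [Field F] [Algebra k F] [Algebra (RatFunc k) F]
  [IsScalarTower k (RatFunc k) F]

/-- Every point of the line has a place above it: a valuation ring dominating the local ring of the
point. -/
theorem Place.exists_liesOver (y : OnePoint k) : ∃ z : Place k F, z.LiesOver y := by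
  let φ : k[X] →ₐ[k] F := aeval (algebraMap (RatFunc k) F (localParam y))
  have hφ : ∀ q, φ q = algebraMap (RatFunc k) F (aeval (localParam y) q) := fun q =>
    aeval_algebraMap_apply _ _ _
  have hinj : Function.Injective φ := fun a b h => by
    rw [hφ, hφ] at h
    exact aeval_localParam_injective y ((algebraMap (RatFunc k) F).injective h)
  have hs0 : localParam y ≠ 0 := by
    have := (aeval_localParam_injective y).ne (X_ne_zero (R := k))
    simpa using this
  let A : Subring F := φ.toRingHom.range
  let I : Ideal A := (Ideal.span {(X : k[X])}).map φ.toRingHom.rangeRestrict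
  have hI : I ≠ ⊤ := by
    rw [Ne, Ideal.eq_top_iff_one]
    intro h1
    obtain ⟨q, hq, hq1⟩ := (Ideal.mem_map_iff_of_surjective _
      φ.toRingHom.rangeRestrict_surjective).mp h1
    have : φ q = φ 1 := by
      rw [map_one]; exact congrArg Subtype.val hq1
    rw [hinj this] at hq
    exact not_isUnit_X (isUnit_of_dvd_one (Ideal.mem_span_singleton.mp hq))
  obtain ⟨O, hO, hnu⟩ := Ideal.image_subset_nonunits_valuationSubring I hI
  have hs : O.valuation (algebraMap (RatFunc k) F (localParam y)) < 1 := by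
    rw [← ValuationSubring.mem_nonunits_iff]
    refine hnu ⟨φ.toRingHom.rangeRestrict X, Ideal.mem_map_of_mem _
      (Ideal.mem_span_singleton_self _), ?_⟩
    change φ X = _
    rw [hφ, aeval_X]
  have hs' : algebraMap (RatFunc k) F (localParam y)⁻¹ ∉ O := by
    rw [map_inv₀, ← O.mem_nonunits_iff, O.mem_nonunits_iff_or] at *
    exact hs.resolve_left (by simpa using hs0)
  refine ⟨⟨O, fun c => hO ⟨C c, by simp [φ]⟩, fun h => hs' (h ▸ ValuationSubring.mem_top _)⟩, ?_⟩
  induction y using OnePoint.rec with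
  | infty =>
    have h : (localParam (∞ : OnePoint k))⁻¹ = RatFunc.X := inv_inv _
    rwa [h] at hs'
  | coe a => exact hs

end Existence

end DefData

/-! ### The ramification invariant -/

noncomputable section
namespace DefData
namespace DeformationDatum

variable {p : ℕ} [Fact p.Prime] {k : Type*} [Field k] [CharP k p]
    {F : Type*} [Field F] [Algebra k F] [Algebra (RatFunc k) F] [IsScalarTower k (RatFunc k) F]
    [FiniteDimensional (RatFunc k) F] [IsGalois (RatFunc k) F]

/-- The rational function `G` with `ω ^ (p - 1) = G (dx) ^ (p - 1)`. -/
theorem exists_pow_eq (D : DeformationDatum p k F) :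
    ∃ (h : F) (G : RatFunc k), h ≠ 0 ∧ G ≠ 0 ∧ D.ω = h • dX F k ∧
      h ^ (p - 1) = algebraMap (RatFunc k) F G := by
  obtain ⟨h, hh⟩ := exists_eq_smul_dX (F := F) D.ω
  have h0 : h ≠ 0 := by
    rintro rfl; exact D.ω_ne_zero (by rw [hh, zero_smul])
  have hdx : dX F k ≠ 0 := by
    intro h1; exact D.ω_ne_zero (by rw [hh, h1, smul_zero])
  have hp1 : p - 1 ≠ 0 := by have := (Fact.out : p.Prime).two_le; omega
  have hβ : ∀ β : F ≃ₐ[RatFunc k] F, β (h ^ (p - 1)) = h ^ (p - 1) := by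
    intro β
    have h1 := D.pullback_ω β
    rw [hh, dX, pullback_smul_D] at h1
    have h2 : (β.restrictScalars k) (algebraMap (RatFunc k) F RatFunc.X) =
        algebraMap (RatFunc k) F RatFunc.X := β.commutes _
    rw [h2] at h1
    change β h • dX F k = _ • h • dX F k at h1
    set c := (D.χ β : ZMod p).val with hc
    rw [Nat.cast_smul_eq_nsmul, ← Nat.cast_smul_eq_nsmul F, smul_smul] at h1
    have h3 : β h = (c : F) * h := by
      rw [← sub_eq_zero, ← sub_smul, smul_eq_zero] at h1
      exact sub_eq_zero.mp (h1.resolve_right hdx)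
    have : CharP F p := charP_of_injective_algebraMap (algebraMap k F).injective p
    have h4 : (c : F) ^ (p - 1) = 1 := by
      have h5 : ((c : ZMod p)) ^ (p - 1) = 1 := by
        rw [hc, ZMod.natCast_zmod_val, ← Units.val_pow_eq_pow_val, ZMod.units_pow_card_sub_one_eq_one,
          Units.val_one]
      have h6 := congrArg (ZMod.castHom dvd_rfl F) h5
      simpa using h6
    rw [map_pow, h3, mul_pow, h4, one_mul]
  obtain ⟨G, hG⟩ := (IsGalois.mem_range_algebraMap_iff_fixed (F := RatFunc k) (h ^ (p - 1))).mpr hβ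
  refine ⟨h, G, h0, ?_, hh, hG.symm⟩
  rintro rfl
  rw [map_zero] at hG
  exact pow_ne_zero _ h0 hG.symm

/-- The order of the differential `dx` of the projective line at `y`. -/
def dxOrder : OnePoint k → ℤ
  | ∞ => -2
  | OnePoint.some _ => 0

/-- The order at `y` of the section `G (dx) ^ (p - 1)` of the `(p - 1)`-st power of the canonical
bundle of the projective line. -/
def tensorOrder (p : ℕ) (G : RatFunc k) (y : OnePoint k) : ℤ :=
  ordAt y G + ((p : ℤ) - 1) * dxOrder y

variable [IsAlgClosed k]

/-- The ramification invariant at a place is governed by the order of `G (dx) ^ (p - 1)`, and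
nonnegative since `ω` has at most simple poles. -/
theorem sigmaAt_eq (D : DeformationDatum p k F) {h : F} {G : RatFunc k} (hG0 : G ≠ 0)
    (hh : h ≠ 0) (hω : D.ω = h • dX F k) (hG : h ^ (p - 1) = algebraMap (RatFunc k) F G)
    {y : OnePoint k} {z : Place k F} (hz : z.LiesOver y) :
    D.sigmaAt z = 1 + (tensorOrder p G y : ℚ) / ((p : ℚ) - 1) ∧ 0 ≤ D.sigmaAt z := by
  have hp2 := (Fact.out : p.Prime).two_le
  obtain ⟨t, ht0, ht, hval, hst, hD⟩ := z.exists_isUniformizer (aeval_localParam_injective y)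
    (exists_aeval_localParam_div y) (Place.valuation_localParam_lt_one hz)
  set H := MulAction.stabilizer (F ≃ₐ[RatFunc k] F) z.ring
  set e := Nat.card H with he
  set s := algebraMap (RatFunc k) F (localParam y) with hs
  have hv0 := ht.valuation_pos
  have hepos : 0 < e := Nat.card_pos
  -- `e` divides `p - 1`, so the ramification is tame
  have hedvd : e ∣ p - 1 := by
    have h1 : e ∣ Nat.card (F ≃ₐ[RatFunc k] F) := Subgroup.card_subgroup_dvd_card H
    have h2 := Subgroup.card_dvd_of_injective D.χ D.χ_injective
    rw [Nat.card_eq_fintype_card (α := (ZMod p)ˣ), ZMod.card_units] at h2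
    exact h1.trans h2
  have hek : ((e : ℤ) : k) ≠ 0 := by
    rw [Int.cast_natCast, Ne, CharP.cast_eq_zero_iff k p]
    intro h1
    have := Nat.le_of_dvd (by omega) (h1.trans hedvd)
    omega
  obtain ⟨w, hw, -, hwv⟩ := ht.exists_D_eq hD (s := s) (n := e) (by rw [hst, zpow_natCast])
  specialize hwv hek
  -- `dx` in terms of `ds`
  obtain ⟨c, hc, hcv⟩ : ∃ c : F, dX F k = c • KaehlerDifferential.D k F s ∧
      z.ring.valuation c = z.ring.valuation s ^ dxOrder y := by
    induction y using OnePoint.rec with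
    | infty =>
      have hsX : algebraMap (RatFunc k) F RatFunc.X = s⁻¹ := by
        rw [hs, ← map_inv₀]
        exact congrArg _ (inv_inv _).symm
      refine ⟨-(s⁻¹ ^ 2), ?_, ?_⟩
      · rw [dX, hsX, Derivation.leibniz_inv]
      · rw [Valuation.map_neg]; simp [dxOrder]
    | coe a =>
      refine ⟨1, ?_, by simp [dxOrder]⟩
      have : s = algebraMap (RatFunc k) F RatFunc.X - algebraMap k F a := by
        rw [hs, IsScalarTower.algebraMap_apply k (RatFunc k) F, ← map_sub]; rfl
      rw [this, map_sub, Derivation.map_algebraMap, sub_zero, one_smul, dX]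
  set m : ℤ := dxOrder y with hm
  obtain ⟨n, hn⟩ := hval h hh
  have hω' : D.ω = (h * c * w) • KaehlerDifferential.D k F t := by
    rw [hω, hc, hw, smul_smul, smul_smul, mul_assoc]
  have hdt : KaehlerDifferential.D k F t ≠ 0 := by
    intro h1; exact D.ω_ne_zero (by rw [hω', h1, smul_zero])
  have hvω : z.ring.valuation (h * c * w) = z.ring.valuation t ^ (n + e * m + (e - 1)) := by
    rw [map_mul, map_mul, hn, hcv, hwv, hst, ← zpow_natCast, ← zpow_mul, ← zpow_add₀ hv0.ne',
      ← zpow_add₀ hv0.ne']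
  have hord : z.order D.ω = n + e * m + (e - 1) := by
    rw [hω']; exact Place.order_eq ht hD hdt hvω
  have hnG : ((p : ℤ) - 1) * n = e * ordAt y G := by
    have h1 := Place.valuation_ratFunc hz hG0
    rw [← hG, map_pow, hn, ← hs, hst, ← zpow_natCast, ← zpow_natCast, ← zpow_mul, ← zpow_mul] at h1
    have h2 := zpow_right_injective₀ hv0 ht.1.ne h1
    rw [Nat.cast_sub (by omega)] at h2
    push_cast at h2
    linarith
  have hordge : -1 ≤ z.order D.ω := by
    obtain ⟨f, hf, hfω⟩ := D.logarithmic
    obtain ⟨i, hi⟩ := hval f hf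
    obtain ⟨w', hw', hwle, -⟩ := ht.exists_D_eq hD hi
    rw [hfω, hw', smul_smul] at hω'
    have h1 : f⁻¹ * w' = h * c * w := by
      rw [← sub_eq_zero, ← sub_smul, smul_eq_zero] at hω'
      exact sub_eq_zero.mp (hω'.resolve_right hdt)
    rw [hord]
    have h2 : z.ring.valuation t ^ (n + e * m + (e - 1)) ≤ z.ring.valuation t ^ (-1 : ℤ) := by
      rw [← hvω, ← h1, map_mul, map_inv₀, hi]
      calc _ ≤ (z.ring.valuation t ^ i)⁻¹ * z.ring.valuation t ^ (i - 1) := by gcongr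
        _ = _ := by
          rw [← zpow_neg, ← zpow_add₀ hv0.ne']; congr 1; ring
    exact (zpow_le_zpow_iff_right_of_lt_one₀ hv0 ht.1).mp h2
  have he' : (e : ℚ) ≠ 0 := by exact_mod_cast hepos.ne'
  have hp' : (p : ℚ) - 1 ≠ 0 := by
    have : (2 : ℚ) ≤ p := by exact_mod_cast hp2
    linarith
  constructor
  · rw [sigmaAt, hord, tensorOrder, ← hm]
    have h3 : ((p : ℚ) - 1) * n = e * ordAt y G := by exact_mod_cast hnG
    change ((_ : ℚ) + 1) / (e : ℚ) = _
    push_cast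
    field_simp
    linear_combination h3
  · rw [sigmaAt]
    have : (-1 : ℚ) ≤ (z.order D.ω : ℚ) := by exact_mod_cast hordge
    exact div_nonneg (by linarith) (by positivity)

/-- One rational function `G` governs all the invariants `σ_y`, whichever places above `y` are used
to compute them. -/
theorem sigma_eq (D : DeformationDatum p k F) : ∃ G : RatFunc k, G ≠ 0 ∧
    ∀ y, D.sigma y = 1 + (tensorOrder p G y : ℚ) / ((p : ℚ) - 1) ∧ 0 ≤ D.sigma y := by
  obtain ⟨h, G, hh, hG0, hω, hG⟩ := D.exists_pow_eq
  refine ⟨G, hG0, fun y => ?_⟩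
  have hex : ∃ z : Place k F, z.LiesOver y := Place.exists_liesOver y
  rw [sigma, dif_pos hex]
  exact D.sigmaAt_eq hG0 hh hω hG hex.choose_spec

end DeformationDatum
end DefData

/-! ### Values and logarithmic derivatives of rational functions -/

noncomputable section
namespace DefData

section Values

variable {k : Type*} [Field k] {f g : RatFunc k}

local notation "ι" => algebraMap k[X] (RatFunc k)

theorem num_mul_eq_of_eq_div {A B : k[X]} (hB : B ≠ 0) (h : f = ι A / ι B) :
    f.num * B = A * f.denom := by
  apply RatFunc.algebraMap_injective k
  have h1 := RatFunc.num_div_denom f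
  have hd := RatFunc.algebraMap_ne_zero f.denom_ne_zero
  have hB' := RatFunc.algebraMap_ne_zero hB
  rw [map_mul, map_mul]
  exact (div_eq_div_iff hd hB').mp (h1.trans h)

/-- The value at a finite point may be read off any fraction, reduced or not. -/
theorem hasValueAt_some_of_eq_div {a c : k} {A B : k[X]} (h : f = ι A / ι B)
    (hB : B.eval a ≠ 0) (hA : A.eval a = c * B.eval a) : HasValueAt f (a : OnePoint k) c := by
  have hB0 : B ≠ 0 := by rintro rfl; simp at hB
  have h1 := congrArg (eval a) (num_mul_eq_of_eq_div hB0 h)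
  rw [eval_mul, eval_mul, hA] at h1
  have hd : f.denom.eval a ≠ 0 := by
    intro hd
    rw [hd, mul_zero] at h1
    obtain ⟨r, s, hrs⟩ := f.isCoprime_num_denom
    have h2 := congrArg (eval a) hrs
    rw [eval_add, eval_mul, eval_mul, hd, (mul_eq_zero.mp h1).resolve_right hB] at h2
    simp at h2
  exact ⟨hd, mul_right_cancel₀ hB (by rw [h1]; ring)⟩

theorem hasValueAt_infty_of_eq_div {c : k} {A B : k[X]} (h : f = ι A / ι B) (hB : B ≠ 0)
    (hAB : A.natDegree ≤ B.natDegree) (hA : A.coeff B.natDegree = c * B.leadingCoeff) :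
    HasValueAt f ∞ c := by
  have h1 := num_mul_eq_of_eq_div hB h
  have hlc : B.leadingCoeff ≠ 0 := leadingCoeff_ne_zero.mpr hB
  have hle : f.num.natDegree ≤ f.denom.natDegree := by
    rcases eq_or_ne A 0 with rfl | hA0
    · rw [zero_mul, mul_eq_zero] at h1
      rw [h1.resolve_right hB]; simp
    · have hn : f.num ≠ 0 := by
        intro hn
        rw [hn, zero_mul, eq_comm, mul_eq_zero] at h1
        exact h1.elim hA0 f.denom_ne_zero
      have h2 := congrArg natDegree h1
      rw [natDegree_mul hn hB, natDegree_mul hA0 f.denom_ne_zero] at h2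
      omega
  refine ⟨hle, mul_right_cancel₀ hlc ?_⟩
  have h2 := congrArg (fun q => coeff q (f.denom.natDegree + B.natDegree)) h1
  beta_reduce at h2
  rw [coeff_mul_add_eq_of_natDegree_le hle le_rfl, add_comm, coeff_mul_add_eq_of_natDegree_le hAB le_rfl, hA,
    f.monic_denom.coeff_natDegree, mul_one] at h2
  exact h2

theorem HasValueAt.unique {y : OnePoint k} {c c' : k} (h : HasValueAt f y c)
    (h' : HasValueAt f y c') : c = c' := by
  induction y using OnePoint.rec with
  | infty => exact h.2.symm.trans h'.2
  | coe a => exact mul_right_cancel₀ h.1 (h.2.symm.trans h'.2)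

theorem HasValueAt.add {y : OnePoint k} {c c' : k} (h : HasValueAt f y c)
    (h' : HasValueAt g y c') : HasValueAt (f + g) y (c + c') := by
  have hdf := RatFunc.algebraMap_ne_zero f.denom_ne_zero
  have hdg := RatFunc.algebraMap_ne_zero g.denom_ne_zero
  have heq : f + g = ι (f.num * g.denom + f.denom * g.num) / ι (f.denom * g.denom) := by
    rw [map_add, map_mul, map_mul, map_mul, ← div_add_div _ _ hdf hdg, RatFunc.num_div_denom,
      RatFunc.num_div_denom]
  have hmul := f.denom.natDegree_mul (q := g.denom) f.denom_ne_zero g.denom_ne_zero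
  induction y using OnePoint.rec with
  | infty =>
    refine hasValueAt_infty_of_eq_div heq (mul_ne_zero f.denom_ne_zero g.denom_ne_zero) ?_ ?_
    · rw [hmul]
      refine (natDegree_add_le _ _).trans (max_le ?_ ?_)
      · exact natDegree_mul_le.trans (Nat.add_le_add_right h.1 _)
      · exact natDegree_mul_le.trans (Nat.add_le_add_left h'.1 _)
    · rw [hmul, coeff_add, coeff_mul_add_eq_of_natDegree_le h.1 le_rfl,
        coeff_mul_add_eq_of_natDegree_le le_rfl h'.1, h.2, h'.2, f.monic_denom.coeff_natDegree,
        g.monic_denom.coeff_natDegree, (f.monic_denom.mul g.monic_denom).leadingCoeff]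
      ring
  | coe a =>
    refine hasValueAt_some_of_eq_div heq ?_ ?_
    · rw [eval_mul]; exact mul_ne_zero h.1 h'.1
    · rw [eval_add, eval_mul, eval_mul, eval_mul, h.2, h'.2]; ring

theorem HasValueAt.mul {y : OnePoint k} {c c' : k} (h : HasValueAt f y c)
    (h' : HasValueAt g y c') : HasValueAt (f * g) y (c * c') := by
  have heq : f * g = ι (f.num * g.num) / ι (f.denom * g.denom) := by
    rw [map_mul, map_mul, ← div_mul_div_comm, RatFunc.num_div_denom, RatFunc.num_div_denom]
  have hmul := f.denom.natDegree_mul (q := g.denom) f.denom_ne_zero g.denom_ne_zero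
  induction y using OnePoint.rec with
  | infty =>
    refine hasValueAt_infty_of_eq_div heq (mul_ne_zero f.denom_ne_zero g.denom_ne_zero) ?_ ?_
    · rw [hmul]
      exact natDegree_mul_le.trans (Nat.add_le_add h.1 h'.1)
    · rw [hmul, coeff_mul_add_eq_of_natDegree_le h.1 h'.1, h.2, h'.2,
        (f.monic_denom.mul g.monic_denom).leadingCoeff]
      ring
  | coe a =>
    refine hasValueAt_some_of_eq_div heq ?_ ?_
    · rw [eval_mul]; exact mul_ne_zero h.1 h'.1
    · rw [eval_mul, eval_mul, h.2, h'.2]; ring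

theorem hasValueAt_C (y : OnePoint k) (c : k) : HasValueAt (RatFunc.C c) y c := by
  have heq : RatFunc.C c = ι (C c) / ι 1 := by simp
  induction y using OnePoint.rec with
  | infty => exact hasValueAt_infty_of_eq_div heq one_ne_zero (by simp) (by simp)
  | coe a => exact hasValueAt_some_of_eq_div heq (by simp) (by simp)

theorem HasValueAt.sum {α : Type*} {s : Finset α} {φ : α → RatFunc k} {c : α → k} {y : OnePoint k}
    (h : ∀ i ∈ s, HasValueAt (φ i) y (c i)) : HasValueAt (∑ i ∈ s, φ i) y (∑ i ∈ s, c i) := by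
  induction s using Finset.cons_induction with
  | empty => simpa using hasValueAt_C y (0 : k)
  | cons a s ha ih =>
    rw [Finset.sum_cons, Finset.sum_cons]
    exact (h a (Finset.mem_cons_self a s)).add
      (ih fun i hi => h i (Finset.mem_cons_of_mem hi))

theorem hasValueAt_X_div_infty (b : k) :
    HasValueAt (RatFunc.X / (RatFunc.X - RatFunc.C b)) ∞ 1 := by
  refine hasValueAt_infty_of_eq_div (A := X) (B := X - C b) (by simp) (X_sub_C_ne_zero b) ?_ ?_
  · rw [natDegree_X, natDegree_X_sub_C]
  · rw [natDegree_X_sub_C, leadingCoeff_X_sub_C, coeff_X_one, one_mul]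

theorem hasValueAt_X_sub_C_div {a b : k} (hab : a ≠ b) :
    HasValueAt ((RatFunc.X - RatFunc.C a) / (RatFunc.X - RatFunc.C b)) (a : OnePoint k) 0 := by
  refine hasValueAt_some_of_eq_div (A := X - C a) (B := X - C b) (by simp) ?_ (by simp)
  simpa [sub_eq_zero] using hab

end Values

section LogDeriv

variable {k : Type*} [Field k] {f g : RatFunc k}

local notation "ι" => algebraMap k[X] (RatFunc k)

theorem ratDeriv_div (A : k[X]) {B : k[X]} (hB : B ≠ 0) :
    ratDeriv (ι A / ι B) = (ι (derivative A) * ι B - ι A * ι (derivative B)) / ι B ^ 2 := by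
  set f := ι A / ι B with hf
  have h1 := num_mul_eq_of_eq_div hB hf
  have h2 := congrArg ι (congrArg derivative h1)
  have h3 := congrArg ι h1
  have hd := RatFunc.algebraMap_ne_zero f.denom_ne_zero
  have hB' := RatFunc.algebraMap_ne_zero hB
  rw [derivative_mul, derivative_mul] at h2
  simp only [map_add, map_mul] at h2 h3
  rw [ratDeriv, div_eq_div_iff (pow_ne_zero 2 hd) (pow_ne_zero 2 hB')]
  linear_combination (ι f.denom * ι B) * h2 - (ι (derivative f.denom) * ι B +
    ι (derivative B) * ι f.denom) * h3

theorem ratDeriv_mul (f g : RatFunc k) : ratDeriv (f * g) = ratDeriv f * g + f * ratDeriv g := by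
  have hdf := RatFunc.algebraMap_ne_zero f.denom_ne_zero
  have hdg := RatFunc.algebraMap_ne_zero g.denom_ne_zero
  have heq : f * g = ι (f.num * g.num) / ι (f.denom * g.denom) := by
    rw [map_mul, map_mul, ← div_mul_div_comm, RatFunc.num_div_denom, RatFunc.num_div_denom]
  rw [heq, ratDeriv_div _ (mul_ne_zero f.denom_ne_zero g.denom_ne_zero)]
  conv_rhs => rw [← RatFunc.num_div_denom f, ← RatFunc.num_div_denom g]
  rw [ratDeriv_div _ f.denom_ne_zero, ratDeriv_div _ g.denom_ne_zero]
  simp only [derivative_mul, map_add, map_mul]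
  field_simp
  ring

/-- The logarithmic derivative of a nonzero rational function, as a homomorphism. -/
def logDerivHom (k : Type*) [Field k] : (RatFunc k)ˣ →* Multiplicative (RatFunc k) where
  toFun f := Multiplicative.ofAdd (ratDeriv (f : RatFunc k) / f)
  map_one' := by
    have h : ratDeriv (1 : RatFunc k) = 0 := by
      have := ratDeriv_div (k := k) 1 one_ne_zero
      simpa using this
    simp [h]
  map_mul' f g := by
    rw [← ofAdd_add, Units.val_mul, ratDeriv_mul, add_div,
      mul_div_mul_right _ _ g.ne_zero, mul_div_mul_left _ _ f.ne_zero]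

theorem X_sub_C_ne_zero' (a : k) : (RatFunc.X - RatFunc.C a : RatFunc k) ≠ 0 := by
  have := RatFunc.algebraMap_ne_zero (X_sub_C_ne_zero a)
  simpa using this

theorem logDeriv_prod_zpow (s : Finset k) (E : k → ℤ) :
    ratDeriv (∏ a ∈ s, (RatFunc.X - RatFunc.C a) ^ E a) / ∏ a ∈ s, (RatFunc.X - RatFunc.C a) ^ E a =
      ∑ a ∈ s, RatFunc.C (E a : k) / (RatFunc.X - RatFunc.C a) := by
  let U : k → (RatFunc k)ˣ := fun a => Units.mk0 _ (X_sub_C_ne_zero' a)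
  have h1 : (∏ a ∈ s, (RatFunc.X - RatFunc.C a) ^ E a : RatFunc k) =
      ((∏ a ∈ s, U a ^ E a : (RatFunc k)ˣ) : RatFunc k) := by
    simp [U]
  have h2 := congrArg Multiplicative.toAdd (map_prod (logDerivHom k) (fun a => U a ^ E a) s)
  rw [h1]
  refine h2.trans ?_
  rw [toAdd_prod]
  refine Finset.sum_congr rfl fun a _ => ?_
  rw [map_zpow, toAdd_zpow]
  have h3 : (logDerivHom k (U a)).toAdd = 1 / (RatFunc.X - RatFunc.C a) := by
    have h4 := ratDeriv_div (k := k) (X - C a) one_ne_zero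
    have h5 : ratDeriv (RatFunc.X - RatFunc.C a : RatFunc k) = 1 := by simpa using h4
    change ratDeriv (RatFunc.X - RatFunc.C a : RatFunc k) / (RatFunc.X - RatFunc.C a) = _
    rw [h5]
  rw [h3, zsmul_eq_mul, map_intCast, mul_one_div]

end LogDeriv
end DefData

/-! ### The strength -/

noncomputable section
namespace DefData

section Degree

variable {k : Type*} [Field k] [IsAlgClosed k]

theorem sum_rootMultiplicity {q : k[X]} {S : Finset k} (hS : ∀ a, q.IsRoot a → a ∈ S) :
    ∑ a ∈ S, (q.rootMultiplicity a : ℤ) = q.natDegree := by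
  classical
  rw [← splits_iff_card_roots.mp (IsAlgClosed.splits q), ← Nat.cast_sum, Nat.cast_inj,
    ← Multiset.sum_count_eq_card (s := S) fun a ha => hS a (isRoot_of_mem_roots ha)]
  exact Finset.sum_congr rfl fun a _ => (count_roots q).symm

/-- A principal divisor on the line has degree zero. -/
theorem exists_finset_sum_ordAt {G : RatFunc k} (hG : G ≠ 0) : ∃ S : Finset k,
    (∀ a ∉ S, ordAt (a : OnePoint k) G = 0) ∧
      ordAt ∞ G + ∑ a ∈ S, ordAt (a : OnePoint k) G = 0 := by
  classical
  have hn := RatFunc.num_ne_zero hG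
  have hd := G.denom_ne_zero
  refine ⟨G.num.roots.toFinset ∪ G.denom.roots.toFinset, fun a ha => ?_, ?_⟩
  · simp only [Finset.mem_union, Multiset.mem_toFinset, mem_roots hn, mem_roots hd, not_or] at ha
    simp [ordAt, rootMultiplicity_eq_zero ha.1, rootMultiplicity_eq_zero ha.2]
  · simp only [ordAt]
    rw [Finset.sum_sub_distrib, sum_rootMultiplicity, sum_rootMultiplicity]
    · ring
    · intro a ha; simp [mem_roots hd, ha.eq_zero]
    · intro a ha; simp [mem_roots hn, ha.eq_zero]

end Degree

theorem dvd_iff_ratModEq {p : ℕ} [Fact p.Prime] (N : ℤ) :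
    RatModEq p (1 + (N : ℚ) / ((p : ℚ) - 1)) 1 ↔ (p : ℤ) ∣ N := by
  have hp := (Fact.out : p.Prime)
  have hp1 : (p : ℚ) - 1 ≠ 0 := by
    have : (2 : ℚ) ≤ p := by exact_mod_cast hp.two_le
    linarith
  constructor
  · rintro ⟨c, hc, h⟩
    have h1 : (N : ℚ) * c.den = p * ((p - 1) * c.num) := by
      have h2 : (c.num : ℚ) = c * c.den := (Rat.mul_den_eq_num c).symm
      rw [h2]
      field_simp at h
      linear_combination (c.den : ℚ) * h
    have h3 : N * c.den = p * ((p - 1) * c.num) := by exact_mod_cast h1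
    refine (Int.Prime.dvd_mul' hp ⟨_, h3⟩).resolve_right fun h4 => hc ?_
    exact_mod_cast h4
  · rintro ⟨M, rfl⟩
    refine ⟨(M : ℚ) / ((p - 1 : ℤ) : ℚ), fun h => ?_, ?_⟩
    · have h1 := (Int.natCast_dvd_natCast.mpr h).trans
        (Rat.divInt_eq_div M (p - 1) ▸ Rat.den_dvd M (p - 1))
      have h2 := Int.le_of_dvd (by have := hp.two_le; omega) h1
      omega
    · push_cast
      ring

namespace DeformationDatum

variable {p : ℕ} [hpf : Fact p.Prime] {k F : Type*} [Field k] [Field F] [Algebra k F]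
  [Algebra (RatFunc k) F] [IsScalarTower k (RatFunc k) F] {D : DeformationDatum p k F}
  {N : OnePoint k → ℤ}

section Classification

variable (hσ : ∀ y, D.sigma y = 1 + (N y : ℚ) / ((p : ℚ) - 1))

include hσ

theorem isCritical_iff (y : OnePoint k) : D.IsCritical y ↔ N y ≠ 0 := by
  have hp1 : (p : ℚ) - 1 ≠ 0 := by
    have : (2 : ℚ) ≤ p := by exact_mod_cast hpf.out.two_le
    linarith
  rw [IsCritical, hσ]
  simp [hp1]

theorem isSpike_iff (y : OnePoint k) : D.IsSpike y ↔ N y ≠ 0 ∧ (p : ℤ) ∣ N y := by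
  rw [IsSpike, isCritical_iff hσ, hσ, dvd_iff_ratModEq]

theorem isSupersingular_iff (y : OnePoint k) : D.IsSupersingular y ↔ N y = 2 := by
  have hp1 : (p : ℚ) - 1 ≠ 0 := by
    have : (2 : ℚ) ≤ p := by exact_mod_cast hpf.out.two_le
    linarith
  rw [IsSupersingular, isCritical_iff hσ, hσ]
  constructor
  · rintro ⟨-, h⟩
    field_simp at h
    have : (N y : ℚ) = 2 := by linarith
    exact_mod_cast this
  · intro h
    refine ⟨by rw [h]; norm_num, ?_⟩
    rw [h]; field_simp; push_cast; ring

theorem isSingular_iff (y : OnePoint k) :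
    D.IsSingular y ↔ N y ≠ 2 ∧ ¬ (p : ℤ) ∣ N y := by
  rw [IsSingular, isCritical_iff hσ, isSupersingular_iff hσ, hσ, dvd_iff_ratModEq]
  constructor
  · exact fun h => h.2
  · refine fun h => ⟨fun h0 => h.2 (h0 ▸ dvd_zero _), h⟩

open Classical in
/-- With `σ_y = 1 + N_y / (p - 1)`, the contribution of `y` to the strength is `N_y`, raised by `p - 1`
at a singularity and lowered by `2` at a supersingular point. -/
theorem localStrength_eq (hp : p ≠ 2) (y : OnePoint k) :
    D.localStrength y = ((N y + (if D.IsSingular y then (p : ℤ) - 1 else 0) -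
      (if D.IsSupersingular y then 2 else 0) : ℤ) : ℚ) := by
  have hp2 := hpf.out.two_le
  have hp1 : (p : ℚ) - 1 ≠ 0 := by
    have : (2 : ℚ) ≤ p := by exact_mod_cast hp2
    linarith
  have h2 : ¬ (p : ℤ) ∣ 2 := fun h => by
    have := Int.le_of_dvd two_pos h
    omega
  rw [localStrength, isSingular_iff hσ, isSpike_iff hσ, isSupersingular_iff hσ, hσ]
  by_cases h1 : (p : ℤ) ∣ N y
  · have hN2 : N y ≠ 2 := fun h => h2 (h ▸ h1)
    by_cases h0 : N y = 0
    · simp [h0]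
    · simp [h0, hN2, h1]
      field_simp
  · by_cases hN2 : N y = 2
    · simp [hN2, h2]
    · simp [hN2, h1]
      field_simp
      ring

/-- The exponents of `Q` reduce modulo `p` to the orders of `G (dx) ^ (p - 1)`. -/
theorem exponent_eq [CharP k p] (y : OnePoint k) :
    ((1 + D.aInv y - D.nu y : ℤ) : k) = (N y : k) := by
  have hp1 : (p : ℚ) - 1 ≠ 0 := by
    have : (2 : ℚ) ≤ p := by exact_mod_cast hpf.out.two_le
    linarith
  have h1 : D.aInv y = p - 1 + N y - (p - 1) * D.nu y := by
    rw [aInv, Int.fract, ← nu]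
    have h2 : ((p : ℚ) - 1) * (D.sigma y - D.nu y) =
        ((p - 1 + N y - (p - 1) * D.nu y : ℤ) : ℚ) := by
      rw [hσ]; push_cast; field_simp
    rw [h2, Int.floor_intCast]
  rw [h1]
  push_cast
  rw [CharP.cast_eq_zero]
  ring

end Classification

/-- The strength and its relation to the `αᵢ = 1 - Nᵢ` follow from the orders `N_y` alone, given that
they add up to the degree `-2 (p - 1)` of a `(p - 1)`-fold differential. -/
theorem strength_properties (hσ : ∀ y, D.sigma y = 1 + (N y : ℚ) / ((p : ℚ) - 1)) (hp : p ≠ 2)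
    (hN : ∀ y, 1 - (p : ℤ) ≤ N y)
    {T : Finset (OnePoint k)} (hT : ∀ y ∉ T, N y = 0) (hsum : ∑ y ∈ T, N y = -2 * ((p : ℤ) - 1))
    {r : ℕ} {x : Fin r → OnePoint k} (hx : Function.Injective x)
    (hsing : Set.range x = {y | D.IsSingular y}) :
    ∃ n : ℤ, D.strength = n ∧
        n = ((r : ℤ) - 2) * ((p : ℤ) - 1) - 2 * (D.numSupersingular : ℤ) ∧
        Even n ∧
        (n : ZMod p) = -∑ i, ((1 - N (x i) : ℤ) : ZMod p) ∧
        ∑ i with ((1 - N (x i) : ℤ) : ZMod p) ≠ 0,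
          ((p : ℤ) - ((((1 - N (x i) : ℤ) : ZMod p)).val : ℤ)) ≤ n := by
  classical
  have hp2 := hpf.out.two_le
  have hS : ∀ y, D.IsSingular y → y ∈ T := fun y hy => by
    by_contra h
    exact ((isSingular_iff hσ y).mp hy).2 (hT y h ▸ dvd_zero _)
  have hSS : ∀ y, D.IsSupersingular y → y ∈ T := fun y hy => by
    by_contra h
    have := (isSupersingular_iff hσ y).mp hy
    rw [hT y h] at this
    norm_num at this
  have hfilter : T.filter D.IsSingular = Finset.univ.image x := by
    ext y
    have : y ∈ Set.range x ↔ D.IsSingular y := by rw [hsing]; rfl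
    simp only [Finset.mem_filter, Finset.mem_image, Finset.mem_univ, true_and]
    rw [← Set.mem_range, this]
    exact ⟨fun h => h.2, fun h => ⟨hS y h, h⟩⟩
  have hsumS : ∀ φ : OnePoint k → ℤ, ∑ y ∈ T with D.IsSingular y, φ y = ∑ i, φ (x i) := fun φ => by
    rw [hfilter, Finset.sum_image fun i _ j _ h => hx h]
  have hd : (D.numSupersingular : ℤ) = ∑ y ∈ T with D.IsSupersingular y, 1 := by
    rw [Finset.sum_const, nsmul_eq_mul, mul_one, Nat.cast_inj, numSupersingular,
      ← Set.ncard_coe_finset]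
    congr 1
    ext y
    simpa using hSS y
  set ℓ : OnePoint k → ℤ := fun y => N y + (if D.IsSingular y then (p : ℤ) - 1 else 0) -
      (if D.IsSupersingular y then 2 else 0) with hℓ
  have hstr : D.strength = ((∑ y ∈ T, ℓ y : ℤ) : ℚ) := by
    rw [strength, finsum_mem_eq_sum_of_inter_support_eq (t := T), Int.cast_sum]
    · exact Finset.sum_congr rfl fun y _ => localStrength_eq hσ hp y
    · ext y
      simp only [Set.mem_inter_iff, Function.mem_support, Finset.mem_coe, Set.mem_ofPred_eq]
      refine and_congr_left fun hy => ⟨fun h => ?_, fun h hc => ?_⟩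
      · by_contra h'
        exact (isCritical_iff hσ y).mp h (hT y h')
      · have hN0 : N y = 0 := by
          by_contra h0
          exact (isCritical_iff hσ y).mpr h0 hc
        rw [localStrength_eq hσ hp, isSingular_iff hσ, isSupersingular_iff hσ] at hy
        simp [hN0] at hy
  have ha : ∑ y ∈ T, ℓ y = ((r : ℤ) - 2) * ((p : ℤ) - 1) - 2 * (D.numSupersingular : ℤ) := by
    rw [hℓ, Finset.sum_sub_distrib, Finset.sum_add_distrib, hsum, ← Finset.sum_filter,
      ← Finset.sum_filter, hsumS, hd, Finset.mul_sum]
    simp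
    ring
  -- a point that is not a singularity contributes a nonnegative multiple of `p`
  have hrest : ∀ y, ¬ D.IsSingular y → 0 ≤ ℓ y ∧ (p : ℤ) ∣ ℓ y := fun y hy => by
    simp only [hℓ, if_neg hy, isSupersingular_iff hσ]
    by_cases h2 : N y = 2
    · simp [h2]
    · have hdvd : (p : ℤ) ∣ N y := by
        by_contra h
        exact hy ((isSingular_iff hσ y).mpr ⟨h2, h⟩)
      simp only [h2, if_false, add_zero, sub_zero]
      refine ⟨?_, hdvd⟩
      obtain ⟨M, hM⟩ := hdvd
      have h3 := hN y
      rw [hM] at h3 ⊢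
      have : 0 ≤ M := by
        by_contra! hneg
        nlinarith
      positivity
  have hsingl : ∀ y, D.IsSingular y → ℓ y = N y + (p - 1) := fun y hy => by
    have := ((isSingular_iff hσ y).mp hy).1
    simp [hℓ, hy, isSupersingular_iff hσ, this]
  have hxs : ∀ i, D.IsSingular (x i) := fun i => by
    have : x i ∈ Set.range x := ⟨i, rfl⟩
    rwa [hsing] at this
  have hsplit : ∑ y ∈ T, ℓ y = ∑ i, (N (x i) + (p - 1)) + ∑ y ∈ T with ¬ D.IsSingular y, ℓ y := by
    rw [← Finset.sum_filter_add_sum_filter_not T D.IsSingular, hsumS]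
    congr 1
    exact Finset.sum_congr rfl fun i _ => hsingl _ (hxs i)
  refine ⟨_, hstr, ha, ?_, ?_, ?_⟩
  · rw [ha]
    have hodd : Odd (p : ℤ) := by exact_mod_cast hpf.out.odd_of_ne_two hp
    exact ((hodd.sub_odd odd_one).mul_left _).sub (even_two_mul _)
  · have h0 : ((∑ y ∈ T with ¬ D.IsSingular y, ℓ y : ℤ) : ZMod p) = 0 := by
      rw [ZMod.intCast_zmod_eq_zero_iff_dvd]
      exact Finset.dvd_sum fun y hy => (hrest y (Finset.mem_filter.mp hy).2).2
    rw [hsplit, Int.cast_add, h0, add_zero, Int.cast_sum, ← Finset.sum_neg_distrib]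
    refine Finset.sum_congr rfl fun i _ => ?_
    push_cast
    rw [ZMod.natCast_self]
    ring
  · rw [hsplit]
    have h0 : 0 ≤ ∑ y ∈ T with ¬ D.IsSingular y, ℓ y :=
      Finset.sum_nonneg fun y hy => (hrest y (Finset.mem_filter.mp hy).2).1
    refine le_trans ?_ (le_add_of_nonneg_right h0)
    rw [Finset.sum_filter]
    refine Finset.sum_le_sum fun i _ => ?_
    have hK : 0 ≤ N (x i) + (p - 1) := by have := hN (x i); linarith
    split_ifs with hα
    · -- `p - α` is the representative of `N + p - 1` in `{1, ..., p - 1}`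
      have h1 : ((p : ℤ) - ((((1 - N (x i) : ℤ) : ZMod p)).val : ℤ)) =
          (((N (x i) + (p - 1) : ℤ) : ZMod p).val : ℤ) := by
        have h2 : ((N (x i) + (p - 1) : ℤ) : ZMod p) = -((1 - N (x i) : ℤ) : ZMod p) := by
          push_cast
          rw [ZMod.natCast_self]
          ring
        rw [h2, ZMod.neg_val, if_neg hα, Nat.cast_sub (ZMod.val_lt _).le]
      rw [h1, ZMod.val_intCast]
      have h3 := Int.emod_add_mul_ediv (N (x i) + (p - 1)) p
      have h4 := mul_nonneg (Int.natCast_nonneg p) (Int.ediv_nonneg hK (Int.natCast_nonneg p))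
      linarith
    · exact hK

end DeformationDatum
end DefData

/-! ### Local exponents and polynomial solutions -/

noncomputable section
namespace DefData

section Operators

variable {k : Type*} [Field k]

theorem hasValueAt_logDeriv_some {s : Finset k} {m : k → k} {a : k} (ha : a ∈ s) :
    HasValueAt ((RatFunc.X - RatFunc.C a) * ∑ b ∈ s, RatFunc.C (m b) / (RatFunc.X - RatFunc.C b))
      (a : OnePoint k) (m a) := by
  classical
  have h : (RatFunc.X - RatFunc.C a) * ∑ b ∈ s, RatFunc.C (m b) / (RatFunc.X - RatFunc.C b) =
      ∑ b ∈ s, RatFunc.C (m b) * ((RatFunc.X - RatFunc.C a) / (RatFunc.X - RatFunc.C b)) := by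
    rw [Finset.mul_sum]
    exact Finset.sum_congr rfl fun b _ => by ring
  have h2 : m a = ∑ b ∈ s, m b * (if a = b then 1 else 0) := by simp [ha]
  rw [h, h2]
  refine HasValueAt.sum fun b _ => (hasValueAt_C _ _).mul ?_
  split_ifs with hab
  · rw [hab, div_self (X_sub_C_ne_zero' b), ← map_one RatFunc.C]
    exact hasValueAt_C _ _
  · exact hasValueAt_X_sub_C_div hab

theorem hasValueAt_logDeriv_infty (s : Finset k) (m : k → k) :
    HasValueAt (RatFunc.X * ∑ b ∈ s, RatFunc.C (m b) / (RatFunc.X - RatFunc.C b)) ∞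
      (∑ b ∈ s, m b) := by
  have h : RatFunc.X * ∑ b ∈ s, RatFunc.C (m b) / (RatFunc.X - RatFunc.C b) =
      ∑ b ∈ s, RatFunc.C (m b) * (RatFunc.X / (RatFunc.X - RatFunc.C b)) := by
    rw [Finset.mul_sum]
    exact Finset.sum_congr rfl fun b _ => by ring
  rw [h]
  refine HasValueAt.sum fun b _ => ?_
  simpa using (hasValueAt_C ∞ (m b)).mul (hasValueAt_X_div_infty b)

theorem hasValueAt_X_mul_derivative_div {u : k[X]} (hu : u ≠ 0) :
    HasValueAt (RatFunc.X * algebraMap k[X] (RatFunc k) (derivative u) /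
      algebraMap k[X] (RatFunc k) u) ∞ (u.natDegree : k) := by
  refine hasValueAt_infty_of_eq_div (A := X * derivative u) (B := u) (by simp) hu ?_ ?_
  · rcases eq_or_ne u.natDegree 0 with h | h
    · rw [natDegree_eq_zero.mp h |>.choose_spec.symm]; simp
    · refine natDegree_mul_le.trans ?_
      rw [natDegree_X]
      have := natDegree_derivative_lt h
      omega
  · rcases eq_or_ne u.natDegree 0 with h | h
    · rw [h]; simp
    · obtain ⟨n, hn⟩ := Nat.exists_eq_succ_of_ne_zero h
      rw [hn, coeff_X_mul, coeff_derivative, leadingCoeff, hn]; push_cast; ring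

theorem hasValueAt_X_sq_mul_derivative_div {u : k[X]} (hu : u ≠ 0) :
    HasValueAt (RatFunc.X ^ 2 * algebraMap k[X] (RatFunc k) (derivative (derivative u)) /
      algebraMap k[X] (RatFunc k) u) ∞ ((u.natDegree : k) * (u.natDegree - 1)) := by
  have hdd : ∀ n, (X ^ 2 * derivative (derivative u)).coeff n = u.coeff n * n * (n - 1) := by
    intro n
    match n with
    | 0 => simp
    | 1 => simp [coeff_X_pow_mul']
    | n + 2 => rw [coeff_X_pow_mul, coeff_derivative, coeff_derivative]; push_cast; ring
  refine hasValueAt_infty_of_eq_div (A := X ^ 2 * derivative (derivative u)) (B := u) (by simp)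
    hu ?_ ?_
  · rw [natDegree_le_iff_coeff_eq_zero]
    intro n hn
    rw [hdd, coeff_eq_zero_of_natDegree_lt hn]; simp
  · rw [hdd, leadingCoeff]; ring

variable {p : ℕ}

/-- The exponents of an operator with a logarithmic derivative as `p₁` and a polynomial solution
`u` without zeros at the poles of `p₁`. -/
theorem DiffOp.hasNormalizedExponent_of_eq {L : DiffOp k} {s : Finset k} {m : k → k} {u : k[X]}
    (hu : u ≠ 0) (hus : ∀ a ∈ s, u.eval a ≠ 0)
    (h1 : L.p₁ = ∑ b ∈ s, RatFunc.C (m b) / (RatFunc.X - RatFunc.C b)) (hL : L.IsSolution u)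
    {y : OnePoint k} {α : ZMod p} (hfin : ∀ a ∈ s, y = a → (α.val : k) = 1 - m a)
    (hy : ∀ a : k, y = a → a ∈ s)
    (hinf : y = ∞ → (α.val : k) = ∑ b ∈ s, m b + 2 * u.natDegree - 1) :
    L.HasNormalizedExponent u.natDegree y α := by
  have hu' := RatFunc.algebraMap_ne_zero hu
  set U := algebraMap k[X] (RatFunc k) u
  set U' := algebraMap k[X] (RatFunc k) (derivative u) with hU'
  set U'' := algebraMap k[X] (RatFunc k) (derivative (derivative u)) with hU''
  have h2 : L.p₂ = RatFunc.C (-1) * (U'' / U + L.p₁ * (U' / U)) := by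
    have h3 : U'' + L.p₁ * U' + L.p₂ * U = 0 := hL
    rw [map_neg, map_one]
    field_simp
    linear_combination h3
  induction y using OnePoint.rec with
  | infty =>
    have hα := hinf rfl
    have hp1 := hasValueAt_logDeriv_infty s m
    rw [← h1] at hp1
    refine ⟨?_, ?_⟩
    · rw [hα]
      convert hp1 using 1
      ring
    · have h3 : RatFunc.X ^ 2 * L.p₂ = RatFunc.C (-1) *
          (RatFunc.X ^ 2 * U'' / U + (RatFunc.X * L.p₁) * (RatFunc.X * U' / U)) := by
        rw [h2]; ring
      rw [h3]
      convert (hasValueAt_C ∞ (-1 : k)).mul ((hasValueAt_X_sq_mul_derivative_div hu).add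
        (hp1.mul (hasValueAt_X_mul_derivative_div hu))) using 1
      rw [hα]
      ring
  | coe a =>
    have ha := hy a rfl
    have hα := hfin a ha rfl
    have hp1 := hasValueAt_logDeriv_some (m := m) ha
    rw [← h1] at hp1
    have hua := hus a ha
    have hv1 : HasValueAt ((RatFunc.X - RatFunc.C a) * U' / U) (a : OnePoint k) 0 :=
      hasValueAt_some_of_eq_div (A := (X - C a) * derivative u) (B := u) (by simp [U, hU']) hua
        (by simp)
    have hv2 : HasValueAt ((RatFunc.X - RatFunc.C a) ^ 2 * U'' / U) (a : OnePoint k) 0 :=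
      hasValueAt_some_of_eq_div (A := (X - C a) ^ 2 * derivative (derivative u)) (B := u)
        (by simp [U, hU'']) hua (by simp)
    refine ⟨?_, ?_⟩
    · rw [hα]
      convert hp1 using 1
      ring
    · have h3 : (RatFunc.X - RatFunc.C a) ^ 2 * L.p₂ = RatFunc.C (-1) *
          ((RatFunc.X - RatFunc.C a) ^ 2 * U'' / U + ((RatFunc.X - RatFunc.C a) * L.p₁) *
            ((RatFunc.X - RatFunc.C a) * U' / U)) := by
        rw [h2]; ring
      rw [h3]
      convert (hasValueAt_C _ (-1 : k)).mul (hv2.add (hp1.mul hv1)) using 1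
      ring

theorem natCast_val_injective [Fact p.Prime] [CharP k p] {α β : ZMod p}
    (h : (α.val : k) = (β.val : k)) : α = β := by
  apply (ZMod.castHom (dvd_refl p) k).injective
  simpa [ZMod.natCast_val] using h

theorem natCast_val_intCast [Fact p.Prime] [CharP k p] (n : ℤ) :
    (((n : ZMod p).val : ℕ) : k) = n := by
  rw [ZMod.natCast_val]
  simp

theorem DiffOp.HasNormalizedExponent.unique [Fact p.Prime] [CharP k p] {L : DiffOp k} {d : ℕ}
    {y : OnePoint k} {α β : ZMod p} (hα : L.HasNormalizedExponent d y α)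
    (hβ : L.HasNormalizedExponent d y β) : α = β := by
  apply natCast_val_injective (k := k)
  induction y using OnePoint.rec with
  | infty => simpa using hα.1.unique hβ.1
  | coe a => simpa using hα.1.unique hβ.1

/-- If the solutions of `L` have rank one over the `p`-th powers, a solution with simple zeros
divides every other nonzero solution: at a zero of the former the order of the latter is congruent
to one modulo `p`. -/
theorem DiffOp.natDegree_le_of_squarefree [IsAlgClosed k] [hpf : Fact p.Prime] {L : DiffOp k}
    (hL : L.HasNonzeroPCurvature p) {u v : k[X]} (hu : L.IsSolution u) (hv : L.IsSolution v)
    (hu0 : u ≠ 0) (hv0 : v ≠ 0) (hsq : ∀ a, u.rootMultiplicity a ≤ 1) :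
    u.natDegree ≤ v.natDegree := by
  classical
  have hp := hpf.out.two_le
  obtain ⟨a, b, hab, h⟩ := hL u v hu hv
  have ha0 : a ≠ 0 := by
    rintro rfl
    rw [zero_pow (by omega), zero_mul, zero_add, mul_eq_zero] at h
    exact hab.elim (fun h => h rfl) fun hb => (pow_ne_zero p hb) (h.resolve_right hv0)
  have hb0 : b ≠ 0 := by
    rintro rfl
    rw [zero_pow (by omega), zero_mul, add_zero, mul_eq_zero] at h
    exact pow_ne_zero p ha0 (h.resolve_right hu0)
  have heq : a ^ p * u = -b ^ p * v := by linear_combination h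
  refine natDegree_le_of_dvd ?_ hv0
  rw [(IsAlgClosed.splits u).dvd_iff_roots_le_roots hu0 hv0, Multiset.le_iff_count]
  intro c
  rw [count_roots, count_roots]
  have h1 := congrArg (rootMultiplicity c) heq
  have hbp : -b ^ p ≠ 0 := neg_ne_zero.mpr (pow_ne_zero p hb0)
  rw [rootMultiplicity_mul (mul_ne_zero (pow_ne_zero p ha0) hu0),
    rootMultiplicity_mul (mul_ne_zero hbp hv0)] at h1
  have h2 : rootMultiplicity c (-b ^ p) = p * rootMultiplicity c b := by
    rw [← count_roots, roots_neg, roots_pow, Multiset.count_nsmul, count_roots]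
  have h3 : rootMultiplicity c (a ^ p) = p * rootMultiplicity c a := by
    rw [← count_roots, roots_pow, Multiset.count_nsmul, count_roots]
  rw [h2, h3] at h1
  by_contra! hlt
  have h4 := hsq c
  have h5 : rootMultiplicity c u = 1 := by omega
  have h6 : rootMultiplicity c v = 0 := by omega
  rw [h5, h6, add_zero] at h1
  have h7 : p ∣ 1 := (Nat.dvd_add_right (dvd_mul_right p _)).mp (h1 ▸ dvd_mul_right p _)
  exact hpf.out.one_lt.ne' (Nat.dvd_one.mp h7)

end Operators

end DefData

/-! ### The operator of a deformation datum -/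

noncomputable section
namespace DefData
namespace DeformationDatum

variable {p : ℕ} {k F : Type*} [Field k] [Field F] [Algebra k F]
  [Algebra (RatFunc k) F] [IsScalarTower k (RatFunc k) F]

theorem operator_isSolution (D : DeformationDatum p k F) (hu : D.uPoly ≠ 0) :
    D.operator.IsSolution D.uPoly := by
  have hu' := RatFunc.algebraMap_ne_zero hu
  simp only [DiffOp.IsSolution, operator]
  field_simp
  ring

theorem CorrespondsTo.eq_operator {D : DeformationDatum p k F} {L : DiffOp k}
    (h : D.CorrespondsTo L) (hu : D.uPoly ≠ 0) : L = D.operator := by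
  have hu' := RatFunc.algebraMap_ne_zero hu
  obtain ⟨h1, h2⟩ := h
  ext1
  · exact h1
  · rw [DiffOp.IsSolution, h1] at h2
    simp only [operator]
    rw [eq_div_iff hu']
    linear_combination h2

theorem numSupersingular_eq_card (D : DeformationDatum p k F) {S : Finset k}
    (hS : ∀ a : k, a ∈ S ↔ D.IsSupersingular a) (hinf : ¬ D.IsSupersingular ∞) :
    D.numSupersingular = S.card := by
  have : {y : OnePoint k | D.IsSupersingular y} = (fun a : k => (a : OnePoint k)) '' S := by
    ext y
    induction y using OnePoint.rec with
    | infty => simpa using hinf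
    | coe a => simpa [OnePoint.coe_eq_coe] using (hS a).symm
  rw [numSupersingular, this, Set.ncard_image_of_injective _ OnePoint.coe_injective,
    Set.ncard_coe_finset]

theorem uPoly_properties (D : DeformationDatum p k F) {S : Finset k}
    (hS : ∀ a : k, D.IsSupersingular a → a ∈ S) (hinf : ¬ D.IsSupersingular ∞) :
    D.uPoly.Monic ∧ D.uPoly.natDegree = D.numSupersingular ∧
      (∀ a : k, ¬ D.IsSupersingular a → D.uPoly.eval a ≠ 0) ∧
      ∀ a, D.uPoly.rootMultiplicity a ≤ 1 := by
  classical
  set S' := S.filter fun a : k => D.IsSupersingular a with hS'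
  have hmem : ∀ a : k, a ∈ S' ↔ D.IsSupersingular a := fun a => by
    rw [hS', Finset.mem_filter]
    exact ⟨fun h => h.2, fun h => ⟨hS a h, h⟩⟩
  have hu : D.uPoly = ∏ a ∈ S', (X - C a) := by
    rw [uPoly, ← finprod_mem_coe_finset]
    have : {a : k | D.IsSupersingular a} = (S' : Set k) := by
      ext a; exact (hmem a).symm
    rw [this]
  refine ⟨?_, ?_, fun a ha => ?_, fun a => ?_⟩
  · rw [hu]; exact monic_prod_X_sub_C _ _
  · rw [hu, natDegree_prod_of_monic _ _ fun a _ => monic_X_sub_C a,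
      D.numSupersingular_eq_card hmem hinf]
    simp
  · rw [hu, eval_prod, Finset.prod_ne_zero_iff]
    intro b hb
    rw [eval_sub, eval_X, eval_C, sub_ne_zero]
    rintro rfl
    exact ha ((hmem a).mp hb)
  · rw [hu, ← count_roots, roots_prod_X_sub_C]
    exact Multiset.nodup_iff_count_le_one.mp S'.nodup a

/-- The coefficient `Q' / Q` has residue `Nᵢ` at `xᵢ`, since `1 + aᵢ - νᵢ ≡ Nᵢ` modulo `p`. -/
theorem operator_p₁_eq [Fact p.Prime] [CharP k p] (D : DeformationDatum p k F) {N : OnePoint k → ℤ}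
    (hσ : ∀ y, D.sigma y = 1 + (N y : ℚ) / ((p : ℚ) - 1)) {s : Finset k}
    (hs : ∀ a : k, a ∈ s ↔ D.IsSingular a) :
    D.operator.p₁ = ∑ a ∈ s, RatFunc.C (N a : k) / (RatFunc.X - RatFunc.C a) := by
  have hQ : D.QFun = ∏ a ∈ s, (RatFunc.X - RatFunc.C a) ^
      (1 + D.aInv (a : OnePoint k) - D.nu (a : OnePoint k)) := by
    rw [QFun, ← finprod_mem_coe_finset]
    have : {a : k | D.IsSingular a} = (s : Set k) := by
      ext a; exact (hs a).symm
    rw [this]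
  change ratDeriv D.QFun / D.QFun = _
  rw [hQ, logDeriv_prod_zpow]
  exact Finset.sum_congr rfl fun a _ => by rw [exponent_eq hσ]

end DeformationDatum
end DefData
end

theorem lemma4p3 {p : ℕ} [Fact p.Prime] (hp : p ≠ 2)
    {k : Type*} [Field k] [IsAlgClosed k] [CharP k p]
    {F : Type*} [Field F] [Algebra k F] [Algebra (RatFunc k) F] [IsScalarTower k (RatFunc k) F]
    [FiniteDimensional (RatFunc k) F] [IsGalois (RatFunc k) F]
    (D : DefData.DeformationDatum p k F)
    {r : ℕ} (x : Fin r → OnePoint k) (hx : Function.Injective x)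
    (hsing : Set.range x = {y | D.IsSingular y}) (hinf : D.IsSingular ∞) :
    -- the sums over critical points are finite
    {y | D.IsCritical y}.Finite ∧
    -- the strength of the deformation datum, with `α` the local exponents of its operator
    (∃ α : Fin r → ZMod p,
      (∀ i, D.operator.HasNormalizedExponent D.numSupersingular (x i) (α i)) ∧
      ∃ n : ℤ, D.strength = n ∧
        n = ((r : ℤ) - 2) * ((p : ℤ) - 1) - 2 * (D.numSupersingular : ℤ) ∧
        Even n ∧
        (n : ZMod p) = -∑ i, α i ∧
        ∑ i with α i ≠ 0, ((p : ℤ) - ((α i).val : ℤ)) ≤ n) ∧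
    -- the strength of a normalized operator to which the deformation datum corresponds
    (∀ (L : DefData.DiffOp k) (u : k[X]) (α : Fin r → ZMod p),
      L.IsFuchsian (Set.range x) → L.HasNilpotentPCurvature → L.HasNonzeroPCurvature p →
      L.IsMinimalSolution u → (∀ a : k, (a : OnePoint k) ∈ Set.range x → u.eval a ≠ 0) →
      (∀ i, L.HasNormalizedExponent u.natDegree (x i) (α i)) →
      D.CorrespondsTo L →
      u.natDegree = D.numSupersingular ∧
      ∃ n : ℤ, D.strength = n ∧
        n = ((r : ℤ) - 2) * ((p : ℤ) - 1) - 2 * (u.natDegree : ℤ) ∧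
        Even n ∧
        (n : ZMod p) = -∑ i, α i ∧
        ∑ i with α i ≠ 0, ((p : ℤ) - ((α i).val : ℤ)) ≤ n) := by
  classical
  obtain ⟨G, hG0, hG⟩ := D.sigma_eq
  set N := DefData.DeformationDatum.tensorOrder p G with hNdef
  have hσ : ∀ y, D.sigma y = 1 + (N y : ℚ) / ((p : ℚ) - 1) := fun y => (hG y).1
  have hp2 := (Fact.out : p.Prime).two_le
  have hN : ∀ y, 1 - (p : ℤ) ≤ N y := fun y => by
    have h1 := (hG y).2
    have hp1 : (0 : ℚ) < (p : ℚ) - 1 := by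
      have : (2 : ℚ) ≤ p := by exact_mod_cast hp2
      linarith
    rw [hσ, ← sub_le_iff_le_add', zero_sub, le_div_iff₀ hp1] at h1
    have h2 : ((1 - (p : ℤ) : ℤ) : ℚ) ≤ N y := by push_cast; linarith
    exact_mod_cast h2
  obtain ⟨S, hS, hSsum⟩ := DefData.exists_finset_sum_ordAt hG0
  have hNfin : ∀ a : k, N a = DefData.ordAt (a : OnePoint k) G := fun a => by
    simp [hNdef, DefData.DeformationDatum.tensorOrder, DefData.DeformationDatum.dxOrder]
  have hNinf : N ∞ = DefData.ordAt ∞ G - 2 * ((p : ℤ) - 1) := by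
    simp only [hNdef, DefData.DeformationDatum.tensorOrder, DefData.DeformationDatum.dxOrder]; ring
  set T : Finset (OnePoint k) := insert ∞ (S.map ⟨_, OnePoint.coe_injective⟩) with hTdef
  have hT : ∀ y ∉ T, N y = 0 := by
    intro y hy
    induction y using OnePoint.rec with
    | infty => exact absurd (Finset.mem_insert_self _ _) hy
    | coe a =>
      rw [hNfin]
      refine hS a fun ha => hy ?_
      exact Finset.mem_insert_of_mem (Finset.mem_map_of_mem ⟨_, OnePoint.coe_injective⟩ ha)
  have hTsum : ∀ φ : OnePoint k → ℤ, ∑ y ∈ T, φ y = φ ∞ + ∑ a ∈ S, φ a := fun φ => by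
    rw [hTdef, Finset.sum_insert (by simp), Finset.sum_map]
    rfl
  have hsum : ∑ y ∈ T, N y = -2 * ((p : ℤ) - 1) := by
    rw [hTsum, hNinf, Finset.sum_congr rfl fun a _ => hNfin a]
    linear_combination hSsum
  have hstr := DefData.DeformationDatum.strength_properties hσ hp hN hT hsum hx hsing
  set α₀ : Fin r → ZMod p := fun i => ((1 - N (x i) : ℤ) : ZMod p) with hα₀
  have hinfN := (DefData.DeformationDatum.isSingular_iff hσ ∞).mp hinf
  have hSS : ∀ a : k, D.IsSupersingular a → a ∈ S := fun a ha => by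
    by_contra h
    have := (DefData.DeformationDatum.isSupersingular_iff hσ _).mp ha
    rw [hNfin, hS a h] at this
    norm_num at this
  obtain ⟨humon, hudeg, hueval, husq⟩ := D.uPoly_properties hSS
    (fun h => hinfN.1 ((DefData.DeformationDatum.isSupersingular_iff hσ _).mp h))
  have hu0 := humon.ne_zero
  set s := S.filter fun a : k => D.IsSingular a with hsdef
  have hs : ∀ a : k, a ∈ s ↔ D.IsSingular a := fun a => by
    rw [hsdef, Finset.mem_filter]
    refine ⟨fun h => h.2, fun h => ⟨?_, h⟩⟩
    by_contra h'
    refine ((DefData.DeformationDatum.isSingular_iff hσ _).mp h).2 ?_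
    rw [hNfin, hS a h']
    exact dvd_zero _
  have hxs : ∀ i, D.IsSingular (x i) := fun i => by
    have : x i ∈ Set.range x := ⟨i, rfl⟩
    rwa [hsing] at this
  -- modulo `p` only the singularities and the supersingular points contribute to the degree of `G`
  have hmod : ∑ a ∈ s, (N a : k) + 2 * (D.uPoly.natDegree : k) + (N ∞ : k) = 2 := by
    have h1 : ∀ a : k, (N a : k) = (if D.IsSingular a then (N a : k) else 0) +
        2 * (if D.IsSupersingular a then 1 else 0) := fun a => by
      rw [DefData.DeformationDatum.isSingular_iff hσ, DefData.DeformationDatum.isSupersingular_iff hσ]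
      by_cases h2 : N a = 2
      · simp [h2]
      · by_cases hd : (p : ℤ) ∣ N a
        · simp [h2, hd, (CharP.intCast_eq_zero_iff k p _).mpr hd]
        · simp [h2, hd]
    have h2 : (D.uPoly.natDegree : k) = ∑ a ∈ S, if D.IsSupersingular (a : OnePoint k) then 1 else 0 := by
      rw [← Finset.sum_filter, Finset.sum_const, nsmul_eq_mul, mul_one, hudeg,
        D.numSupersingular_eq_card (S := S.filter fun a : k => D.IsSupersingular a)
          (fun a => by simpa using hSS a) fun h => hinfN.1 ((DefData.DeformationDatum.isSupersingular_iff hσ _).mp h)]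
    have h3 := congrArg (Int.cast (R := k)) hsum
    rw [hTsum, Int.cast_add, Int.cast_sum, Finset.sum_congr rfl fun a _ => h1 a,
      Finset.sum_add_distrib, ← Finset.mul_sum, ← h2, ← Finset.sum_filter] at h3
    push_cast at h3
    rw [CharP.cast_eq_zero k p] at h3
    linear_combination h3
  have hexp : ∀ i, D.operator.HasNormalizedExponent D.numSupersingular (x i) (α₀ i) := fun i => by
    rw [← hudeg]
    refine DefData.DiffOp.hasNormalizedExponent_of_eq hu0 (s := s) (m := fun a => (N a : k))
      (fun a ha => hueval a fun h => ((hs a).mp ha).2.1 h) (D.operator_p₁_eq hσ hs)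
      (D.operator_isSolution hu0) (fun a _ h => ?_) (fun a h => (hs a).mpr (h ▸ hxs i)) (fun h => ?_)
    · rw [hα₀]
      simp only [DefData.natCast_val_intCast, h]
      push_cast; ring
    · rw [hα₀]
      simp only [DefData.natCast_val_intCast, h]
      push_cast
      linear_combination -hmod
  refine ⟨T.finite_toSet.subset fun y hy => ?_, ⟨α₀, hexp, hstr⟩, ?_⟩
  · by_contra h
    exact (DefData.DeformationDatum.isCritical_iff hσ y).mp hy (hT y h)
  · intro L u α _ _ hnz hmin _ hα hcorr
    have hL := hcorr.eq_operator hu0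
    have hdeg : u.natDegree = D.numSupersingular := by
      rw [← hudeg]
      exact le_antisymm (hmin.2.2 _ hu0 hcorr.2)
        (DefData.DiffOp.natDegree_le_of_squarefree hnz hcorr.2 hmin.2.1 hu0 hmin.1.ne_zero husq)
    have hαeq : α = α₀ := by
      funext i
      have h1 := hα i
      rw [hL, hdeg] at h1
      exact h1.unique (hexp i)
    rw [hdeg, hαeq]
    exact ⟨rfl, hstr⟩
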